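/- **Theorem (Mixup Decomposition Theorem).** *Setting.* Let $L_1\subseteq\dots\subseteq L_n$ and $K_1\subseteq\dots\subseteq K_n$ be simplex-wise filtrations of finite simplicial complexes: with $L_0=K_0=\emptyset$, each $L_{i}\setminus L_{i-1}$ and each $K_{i}\setminus K_{i-1}$ contains at most one simplex. Assume $L_i\subseteq K_i$ for all $i$, and that $\sigma\in L_i\setminus L_{i-1}$ implies $\sigma\notin K_{i-1}$. Write $L=L_n$ and $K=K_n$. The *index* of a simplex is the $i$ at which it appears. Fix $k\ge 0$ and let homology have coefficients $\mathbb Z/2$. Let $H_k(L)$, $H_k(K)$ be the persistence modules $i\mapsto H_k(L_i)$, $i\mapsto H_k(K_i)$, $1\le i\le n$, and let $H_k(\iota)\colon H_k(L)\to H_k(K)$ be the map induced by the inclusions; its image is taken index by index. A barcode of a persistence module is a multiset of nonempty intervals $[b,d)$, $1\le b<d\le n+1$, such that the module is isomorphic to the direct sum of the corresponding interval modules. *Mixup barcode.* The barcode of $H_k(L)$ and that of $\operatorname{im}H_k(\iota)$ each contain at most one interval with a given birth index, and there is a surjective matching of the former onto the latter that matches intervals with the same birth index. The (index) mixup barcode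 of $L\hookrightarrow K$ in degree $k$ is the multiset consisting of a triple $(b,d',d)$ for each matched pair $[b,d)$, $[b,d')$ and a triple $(b,b,d)$ for each unmatched interval $[b,d)$ of $H_k(L)$. For a real-valued function $f$ on the simplices of $K$ that is monotone with respect to the filtration index, the mixup barcode in terms of filtration values is obtained from it by replacing each index $i\le n$ by the value of $f$ on the simplex with index $i$, and $n+1$ by $\infty$. *Algorithm.* The pivot of a nonzero column of a matrix is the greatest index of a nonzero entry. To *reduce* a matrix over $\mathbb Z/2$, go through the columns $j$ from left to right and, while some column $l<j$ has the same pivot as column $j$, add column $l$ to column $j$. The mixup algorithm does the following. 1. Let $BK$ be the matrix whose columns are the boundaries of the $k$- and $(k+1)$-simplices of $K$, in the order of their indices. Its rows are labelled by the $(k-1)$- and $k$-simplices of $K$, those of $L$ first and then those of $K\setminus L$, each group ordered by index. 2. Let $BL$ be obtained from $BK$ by setting to zero all entries in rows or columns of simplices of $K\setminus L$. 3. Reduce $BL$ and $BK$. 4. For each $k$-simplex $\sigma$ of $L$ whose column in the reduced $BL$ is zero, find $\tau$ such that column $\tau$ of the reduced $BL$ has pivot $\sigma$, and $\tau'$ such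 that column $\tau'$ of the reduced $BK$ has pivot $\sigma$. Record the triple $(f(\sigma),f(\tau'),f(\tau))$, where $f(\tau)$, respectively $f(\tau')$, is replaced by $\infty$ if no such $\tau$, respectively $\tau'$, exists. *Claim.* The algorithm returns a correct mixup barcode of $L\hookrightarrow K$ in degree $k$: * Run with the filtration index in place of $f$, and with $n+1$ written for $\infty$, it returns the index mixup barcode. Every triple satisfies $1\le b\le d'\le d\le n+1$, so each persistence bar $[b,d)$ of $H_k(L)$ is split into an image sub-bar $[b,d')$ and a mixup sub-bar $[d',d)$. * For every real-valued order-preserving $f$ it returns the mixup barcode in terms of filtration values, and $b\le d'\le d$ for every triple $(b,d',d)$. -/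

import Mathlib

/-! ### Filtrations -/

/-- A simplex-wise filtration `K_1 ⊆ K_2 ⊆ ⋯ ⊆ K_n` of simplicial complexes on the vertex set `V`,
with `K_0 = ∅`: each complex differs from the preceding one by at most one simplex.
The sequence is continued by `K_i = K_n` for `i ≥ n`. -/
structure SimplexwiseFiltration (V : Type*) (n : ℕ) where
  complex : ℕ → PreAbstractSimplicialComplex V
  complex_zero : complex 0 = ⊥
  mono : Monotone complex
  stationary : ∀ i, n ≤ i → complex i = complex n
  simplexwise : ∀ i, ((complex (i + 1)).faces \ (complex i).faces).Subsingleton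

namespace SimplexwiseFiltration

variable {V : Type*} {n : ℕ}

/-- The total complex `K_n`. -/
def total (K : SimplexwiseFiltration V n) : PreAbstractSimplicialComplex V := K.complex n

/-- The index of a simplex: the first `i` with `σ ∈ K_i`. -/
noncomputable def index (K : SimplexwiseFiltration V n) (σ : Finset V) : ℕ :=
  sInf {i | σ ∈ K.complex i}

/-- `L` is included in `K`, and a simplex entering `L` at a step enters `K` at the same step. -/
structure IsFilteredSubcomplex (L K : SimplexwiseFiltration V n) : Prop where
  le : ∀ i, L.complex i ≤ K.complex i
  not_mem_of_enters : ∀ i σ, σ ∈ L.complex (i + 1) → σ ∉ L.complex i → σ ∉ K.complex i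

/-- `f` is order-preserving: it is monotone along the filtration order of the simplices. -/
def OrderPreserving {α : Type*} [Preorder α] (K : SimplexwiseFiltration V n)
    (f : Finset V → α) : Prop :=
  ∀ σ ∈ K.total, ∀ τ ∈ K.total, K.index σ ≤ K.index τ → f σ ≤ f τ

open Classical in
/-- The simplex of `K_i` that is not in `K_{i-1}`, if there is one. -/
noncomputable def simplexAt (K : SimplexwiseFiltration V n) (i : ℕ) : Option (Finset V) :=
  if h : ∃ σ, σ ∈ K.complex i ∧ σ ∉ K.complex (i - 1) then some h.choose else none

/-- The list of all simplices of `K`, ordered by the filtration index. -/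
noncomputable def simplices (K : SimplexwiseFiltration V n) : List (Finset V) :=
  (List.range' 1 n).filterMap K.simplexAt

end SimplexwiseFiltration

/-! ### Persistence modules and barcodes -/

/-- A persistence module over `ℤ/2`, indexed by `{1, …, n}`. -/
structure PersistenceModule (n : ℕ) where
  obj : Set.Icc 1 n → Type*
  [addCommGroup : ∀ i, AddCommGroup (obj i)]
  [module : ∀ i, Module (ZMod 2) (obj i)]
  map : ∀ {i j : Set.Icc 1 n}, i ≤ j → obj i →ₗ[ZMod 2] obj j
  map_refl : ∀ i, map (le_refl i) = LinearMap.id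
  map_trans : ∀ {i j k : Set.Icc 1 n} (hij : i ≤ j) (hjk : j ≤ k),
    map hjk ∘ₗ map hij = map (hij.trans hjk)

namespace PersistenceModule

attribute [instance] PersistenceModule.addCommGroup PersistenceModule.module

variable {n : ℕ}

/-- A map of persistence modules. -/
structure Hom (M N : PersistenceModule n) where
  app : ∀ i, M.obj i →ₗ[ZMod 2] N.obj i
  naturality : ∀ {i j : Set.Icc 1 n} (h : i ≤ j), N.map h ∘ₗ app i = app j ∘ₗ M.map h

/-- An isomorphism of persistence modules. -/
structure Iso (M N : PersistenceModule n) where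
  app : ∀ i, M.obj i ≃ₗ[ZMod 2] N.obj i
  naturality : ∀ {i j : Set.Icc 1 n} (h : i ≤ j),
    N.map h ∘ₗ (app i).toLinearMap = (app j).toLinearMap ∘ₗ M.map h

/-- The (elementwise) image of a map of persistence modules. -/
def Hom.image {M N : PersistenceModule n} (φ : Hom M N) : PersistenceModule n where
  obj i := LinearMap.range (φ.app i)
  map {i j} h := (N.map h).restrict (by
    rintro _ ⟨x, rfl⟩
    exact ⟨M.map h x, (LinearMap.congr_fun (φ.naturality h) x).symm⟩)
  map_refl i := by
    ext x
    simp [N.map_refl]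
  map_trans hij hjk := by
    ext x
    exact LinearMap.congr_fun (N.map_trans hij hjk) x.1

/-- The (elementwise) direct sum of a finite family of persistence modules. -/
def directSum {J : Type*} [Fintype J] (M : J → PersistenceModule n) : PersistenceModule n where
  obj i := ∀ j, (M j).obj i
  map h := LinearMap.pi fun j => (M j).map h ∘ₗ LinearMap.proj j
  map_refl i := by
    ext x j
    simp [(M j).map_refl]
  map_trans hij hjk := by
    refine LinearMap.ext fun x => funext fun j => ?_
    exact LinearMap.congr_fun ((M j).map_trans hij hjk) (x j)

/-- The interval module supported on `[b, d)`: it is `ℤ/2` at the indices `b ≤ i < d` and `0` at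
the others, and its maps are the identity wherever possible and zero otherwise. -/
def interval (n b d : ℕ) : PersistenceModule n where
  obj i := ↥(if (i : ℕ) ∈ Set.Ico b d then ⊤ else ⊥ : Submodule (ZMod 2) (ZMod 2))
  map {_ j} _ := LinearMap.codRestrict _
    ((if (j : ℕ) ∈ Set.Ico b d then LinearMap.id else 0) ∘ₗ Submodule.subtype _) (by
      intro x
      split_ifs <;> simp)
  map_refl i := by
    ext ⟨x, hx⟩
    by_cases hi : (i : ℕ) ∈ Set.Ico b d
    · simp [hi]
    · rw [if_neg hi, Submodule.mem_bot] at hx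
      simp [hx]
  map_trans {i j k} hij hjk := by
    ext ⟨x, hx⟩
    by_cases hi : (i : ℕ) ∈ Set.Ico b d
    · by_cases hk : (k : ℕ) ∈ Set.Ico b d
      · have hj : (j : ℕ) ∈ Set.Ico b d := ⟨hi.1.trans hij, lt_of_le_of_lt hjk hk.2⟩
        simp [hj, hk]
      · simp [hk]
    · rw [if_neg hi, Submodule.mem_bot] at hx
      simp [hx]

/-- The multiset `B` of nonempty intervals `[b, d) ⊆ {1, …, n}`, stored as pairs `(b, d)`, is a
barcode of `M`: the module `M` is isomorphic to the direct sum of the interval modules. -/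
def IsBarcode (M : PersistenceModule n) (B : Multiset (ℕ × ℕ)) : Prop :=
  (∀ I ∈ B, 1 ≤ I.1 ∧ I.1 < I.2 ∧ I.2 ≤ n + 1) ∧
    ∃ (N : ℕ) (I : Fin N → ℕ × ℕ), B = Finset.univ.val.map I ∧
      Nonempty (Iso M (directSum fun j => interval n (I j).1 (I j).2))

end PersistenceModule

/-! ### Simplicial homology over `ℤ/2` -/

section Homology

variable {V : Type*} [DecidableEq V]

/-- The differential, on the `ℤ/2`-vector space with basis all finite vertex sets: a simplex is
sent to the sum of its facets, where the boundary of a vertex is zero. -/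
noncomputable def simplicialBoundary (V : Type*) [DecidableEq V] :
    (Finset V →₀ ZMod 2) →ₗ[ZMod 2] (Finset V →₀ ZMod 2) :=
  Finsupp.lsum (ZMod 2) fun σ => LinearMap.toSpanSingleton (ZMod 2) (Finset V →₀ ZMod 2)
    (if 2 ≤ σ.card then ∑ v ∈ σ, Finsupp.single (σ.erase v) 1 else 0)

/-- `C_k(X)`: the space spanned by the `k`-simplices of `X`. -/
def simplicialChains {V : Type*} (X : PreAbstractSimplicialComplex V) (k : ℕ) :
    Submodule (ZMod 2) (Finset V →₀ ZMod 2) :=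
  Finsupp.supported (ZMod 2) (ZMod 2) {σ | σ ∈ X ∧ σ.card = k + 1}

/-- `Z_k(X)`. -/
noncomputable def simplicialCycles (X : PreAbstractSimplicialComplex V) (k : ℕ) :
    Submodule (ZMod 2) (Finset V →₀ ZMod 2) :=
  simplicialChains X k ⊓ LinearMap.ker (simplicialBoundary V)

/-- `B_k(X)`. -/
noncomputable def simplicialBoundaries (X : PreAbstractSimplicialComplex V) (k : ℕ) :
    Submodule (ZMod 2) (Finset V →₀ ZMod 2) :=
  (simplicialChains X (k + 1)).map (simplicialBoundary V)

/-- `B_k(X)` as a subspace of `Z_k(X)`. -/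
noncomputable def boundariesInCycles (X : PreAbstractSimplicialComplex V) (k : ℕ) :
    Submodule (ZMod 2) (simplicialCycles X k) :=
  (simplicialBoundaries X k).submoduleOf (simplicialCycles X k)

/-- `H_k(X) = Z_k(X) / B_k(X)`. -/
abbrev SimplicialHomology (X : PreAbstractSimplicialComplex V) (k : ℕ) : Type _ :=
  simplicialCycles X k ⧸ boundariesInCycles X k

theorem simplicialChains_mono {V : Type*} {X Y : PreAbstractSimplicialComplex V} (h : X ≤ Y) (k : ℕ) :
    simplicialChains X k ≤ simplicialChains Y k :=
  Finsupp.supported_mono fun _ hσ => ⟨h hσ.1, hσ.2⟩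

theorem simplicialCycles_mono {X Y : PreAbstractSimplicialComplex V} (h : X ≤ Y) (k : ℕ) :
    simplicialCycles X k ≤ simplicialCycles Y k :=
  inf_le_inf_right _ (simplicialChains_mono h k)

theorem simplicialBoundaries_mono {X Y : PreAbstractSimplicialComplex V} (h : X ≤ Y) (k : ℕ) :
    simplicialBoundaries X k ≤ simplicialBoundaries Y k :=
  Submodule.map_mono (simplicialChains_mono h (k + 1))

/-- The map `H_k(X) → H_k(Y)` induced by an inclusion `X ⊆ Y`. -/
noncomputable def simplicialHomologyMap {X Y : PreAbstractSimplicialComplex V} (h : X ≤ Y)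
    (k : ℕ) : SimplicialHomology X k →ₗ[ZMod 2] SimplicialHomology Y k :=
  Submodule.mapQ _ _ (Submodule.inclusion (simplicialCycles_mono h k))
    fun _ hx => simplicialBoundaries_mono (V := V) h k hx

namespace SimplexwiseFiltration

variable {n : ℕ}

/-- The persistence module `H_k(K)`. -/
noncomputable def homology (K : SimplexwiseFiltration V n) (k : ℕ) : PersistenceModule n where
  obj i := SimplicialHomology (K.complex i) k
  addCommGroup i := Submodule.Quotient.addCommGroup (boundariesInCycles (K.complex i) k)
  module i := Submodule.Quotient.module (boundariesInCycles (K.complex i) k)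
  map h := simplicialHomologyMap (K.mono h) k
  map_refl i := by
    refine Submodule.linearMap_qext _ (LinearMap.ext fun x => ?_)
    rfl
  map_trans hij hjk := by
    refine Submodule.linearMap_qext _ (LinearMap.ext fun x => ?_)
    rfl

/-- The map of persistence modules `H_k(ι) : H_k(L) → H_k(K)` induced by the inclusions
`L_i ⊆ K_i`. -/
noncomputable def homologyMap {L K : SimplexwiseFiltration V n}
    (h : ∀ i, L.complex i ≤ K.complex i) (k : ℕ) :
    PersistenceModule.Hom (L.homology k) (K.homology k) where
  app i := simplicialHomologyMap (h i) k
  naturality _ := by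
    refine Submodule.linearMap_qext _ (LinearMap.ext fun x => ?_)
    rfl

end SimplexwiseFiltration

/-! ### Mixup barcodes -/

/-- `T` is the (index) mixup barcode in degree `k` of the inclusion `L ↪ K`. A surjective matching
of a barcode of `H_k(L)` onto a barcode of `im H_k(ι)` which matches intervals with the same birth
index is given by the multiset `P` of triples `(b, d', d)`, one for each pair of matched intervals
`[b, d)` and `[b, d')`, and the multiset `U` of the unmatched intervals of `H_k(L)`. (In either
barcode there is at most one interval with a given birth index.) -/
def IsMixupBarcode {n : ℕ} {L K : SimplexwiseFiltration V n} (h : L.IsFilteredSubcomplex K)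
    (k : ℕ) (T : Multiset (ℕ × ℕ × ℕ)) : Prop :=
  ∃ (P : Multiset (ℕ × ℕ × ℕ)) (U : Multiset (ℕ × ℕ)),
    (L.homology k).IsBarcode (P.map (fun t => (t.1, t.2.2)) + U) ∧
    (SimplexwiseFiltration.homologyMap h.le k).image.IsBarcode (P.map fun t => (t.1, t.2.1)) ∧
    T = P + U.map fun I => (I.1, I.1, I.2)

/-- `x` is the filtration value that replaces the index `i`: the value of the simplex with index
`i`, respectively `∞` for the index `n + 1`. -/
def SimplexwiseFiltration.HasFiltrationValue {n : ℕ} (K : SimplexwiseFiltration V n)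
    {α : Type*} (f : Finset V → α) (i : ℕ) (x : WithTop α) : Prop :=
  (i = n + 1 ∧ x = ⊤) ∨ ∃ σ ∈ K.total, K.index σ = i ∧ x = (f σ : WithTop α)

/-- `S` is the mixup barcode in degree `k` of `L ↪ K` in terms of filtration values: it arises from
the index mixup barcode by replacing the indices by the filtration values. -/
def IsMixupBarcodeWithValues {n : ℕ} {L K : SimplexwiseFiltration V n}
    (h : L.IsFilteredSubcomplex K) (k : ℕ) {α : Type*} (f : Finset V → α)
    (S : Multiset (α × WithTop α × WithTop α)) : Prop :=
  ∃ T, IsMixupBarcode h k T ∧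
    Multiset.Rel (fun t s => K.HasFiltrationValue f t.1 (s.1 : WithTop α) ∧
      K.HasFiltrationValue f t.2.1 s.2.1 ∧ K.HasFiltrationValue f t.2.2 s.2.2) T S

end Homology

/-! ### The reduction algorithm -/

section Reduction

variable {m c : ℕ}

/-- The pivot of column `j`: the greatest index of a nonzero entry (`⊥` for a zero column). -/
def pivot (R : Matrix (Fin m) (Fin c) (ZMod 2)) (j : Fin c) : WithBot (Fin m) :=
  (Finset.univ.filter fun i => R i j ≠ 0).max

/-- A column `l < j` which has a pivot, and the same one as column `j`. -/
def findConflict (R : Matrix (Fin m) (Fin c) (ZMod 2)) (j : Fin c) : Option (Fin c) :=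
  (List.finRange c).find? fun l => decide (l < j ∧ pivot R j ≠ ⊥ ∧ pivot R l = pivot R j)

theorem pivot_updateCol_lt {R : Matrix (Fin m) (Fin c) (ZMod 2)} {j l : Fin c}
    (h : findConflict R j = some l) :
    pivot (R.updateCol j (R.col j + R.col l)) j < pivot R j := by
  obtain ⟨-, hne, heq⟩ := of_decide_eq_true
    (List.find?_some (p := fun l => decide (l < j ∧ pivot R j ≠ ⊥ ∧ pivot R l = pivot R j)) h)
  obtain ⟨r, hr⟩ := WithBot.ne_bot_iff_exists.1 hne
  have key : ∀ a b : ZMod 2, a ≠ 0 → b ≠ 0 → a + b = 0 := by decide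
  have hj : R r j ≠ 0 := by simpa using Finset.mem_of_max hr.symm
  have hl : R r l ≠ 0 := by simpa using Finset.mem_of_max (heq.trans hr.symm)
  rw [← hr, pivot, Finset.max_eq_sup_withBot, Finset.sup_lt_iff (WithBot.bot_lt_coe r)]
  intro i hi
  rw [Finset.mem_filter, Matrix.updateCol_self] at hi
  have hi2 : R i j + R i l ≠ 0 := hi.2
  refine WithBot.coe_lt_coe.2 (lt_of_le_of_ne ?_ ?_)
  · by_cases h1 : R i j = 0
    · have h2 : R i l ≠ 0 := fun h2 => hi2 (by rw [h1, h2, add_zero])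
      exact Finset.le_max_of_eq (s := Finset.univ.filter fun i => R i l ≠ 0) (by simp [h2])
        (heq.trans hr.symm)
    · exact Finset.le_max_of_eq (s := Finset.univ.filter fun i => R i j ≠ 0) (by simp [h1])
        hr.symm
  · rintro rfl
    exact hi2 (key _ _ hj hl)

/-- The `while` loop for column `j`: as long as there is a column `l < j` with the same pivot,
column `l` is added to column `j` modulo 2. -/
def reduceColumn (j : Fin c) (R : Matrix (Fin m) (Fin c) (ZMod 2)) :
    Matrix (Fin m) (Fin c) (ZMod 2) :=
  match _h : findConflict R j with
  | some l => reduceColumn j (R.updateCol j (R.col j + R.col l))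
  | none => R
termination_by wellFounded_lt.wrap (pivot R j)
decreasing_by exact pivot_updateCol_lt _h

/-- The standard reduction algorithm: the columns are treated from left to right. -/
def reduceMatrix (R : Matrix (Fin m) (Fin c) (ZMod 2)) : Matrix (Fin m) (Fin c) (ZMod 2) :=
  (List.finRange c).foldl (fun R j => reduceColumn j R) R

/-- A column of the matrix `R`, with rows labelled by `rows`, whose pivot is the row of `σ`. -/
def findPivot {V : Type*} [DecidableEq V] (rows : List (Finset V))
    (R : Matrix (Fin rows.length) (Fin c) (ZMod 2)) (σ : Finset V) : Option (Fin c) :=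
  (List.finRange c).find? fun t =>
    decide (∃ r : Fin rows.length, pivot R t = (r : WithBot _) ∧ rows.get r = σ)

end Reduction

/-! ### The mixup barcode algorithm -/

section Algorithm

variable {V : Type*} [DecidableEq V]

/-- The matrix of boundaries of the simplices `cols` in terms of the simplices `rows`. -/
def boundaryMatrix (rows cols : List (Finset V)) :
    Matrix (Fin rows.length) (Fin cols.length) (ZMod 2) :=
  Matrix.of fun r j =>
    if rows.get r ⊆ cols.get j ∧ (rows.get r).card + 1 = (cols.get j).card then 1 else 0

/-- The columns, labelled by the `k`- and `(k+1)`-simplices in the order of the filtration. -/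
def mixupCols (simplices : List (Finset V)) (k : ℕ) : List (Finset V) :=
  simplices.filter fun σ => σ.card = k + 1 ∨ σ.card = k + 2

/-- The rows, labelled by the `(k-1)`- and `k`-simplices, reordered so that the simplices of `L`
come first while the relative order within `L` and within `K \ L` is retained. -/
def mixupRows (simplices : List (Finset V)) (inL : Finset V → Bool) (k : ℕ) : List (Finset V) :=
  let rows := simplices.filter fun σ => σ.card = k ∨ σ.card = k + 1
  rows.filter (fun σ => inL σ) ++ rows.filter fun σ => !inL σ

/-- The mixup barcode algorithm in degree `k`. The input is the list of the simplices of `K`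
ordered by the filtration index, the test for membership in `L`, and the filtration values.
The output is the list of the recorded triples `(birth, death', death)`. -/
def mixupAlgorithm (simplices : List (Finset V)) (inL : Finset V → Bool) {α : Type*}
    (f : Finset V → α) (k : ℕ) : List (α × WithTop α × WithTop α) :=
  let cols := mixupCols simplices k
  let rows := mixupRows simplices inL k
  let BK := boundaryMatrix rows cols
  let BL : Matrix (Fin rows.length) (Fin cols.length) (ZMod 2) :=
    Matrix.of fun r j => if inL (rows.get r) ∧ inL (cols.get j) then BK r j else 0
  let RL := reduceMatrix BL
  let RK := reduceMatrix BK
  let value : Option (Fin cols.length) → WithTop α := fun t => match t with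
    | some τ => (f (cols.get τ) : WithTop α)
    | none => ⊤
  ((List.finRange cols.length).filter fun s =>
      decide ((cols.get s).card = k + 1 ∧ inL (cols.get s) ∧ ∀ r, RL r s = 0)).map fun s =>
    let σ := cols.get s
    (f σ, value (findPivot rows RK σ), value (findPivot rows RL σ))

open Classical in
/-- The output of the mixup barcode algorithm for the filtrations `L` and `K`. -/
noncomputable def mixupOutput {n : ℕ} (L K : SimplexwiseFiltration V n) {α : Type*}
    (f : Finset V → α) (k : ℕ) : List (α × WithTop α × WithTop α) :=
  mixupAlgorithm K.simplices (fun σ => decide (σ ∈ L.total)) f k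

/-- The output of the algorithm for the filtration index in the place of the filtration value, with
`n + 1` written for `∞`. -/
noncomputable def mixupIndexOutput {n : ℕ} (L K : SimplexwiseFiltration V n) (k : ℕ) :
    List (ℕ × ℕ × ℕ) :=
  (mixupOutput L K K.index k).map fun t => (t.1, t.2.1.untopD (n + 1), t.2.2.untopD (n + 1))

end Algorithm

/-! ### Leading entries -/

/-! Everything is expressed through leading simplices, the simplices of greatest index in the
support of a chain. Since a simplex enters `L` and `K` at the same step, `L_i = L ∩ K_i`, and the
index in `K` orders the simplices of both filtrations.

Linear algebra: reduction changes each column by a combination of the columns to its left and leaves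
nonzero columns with distinct pivots. Hence the pivots among an initial segment of reduced columns
are exactly the leading entries of the nonzero vectors spanned by that segment
(`exists_reduceMatrix_lead`), and a reduced column is zero iff the original column depends on
earlier ones (`reduceMatrix_col_eq_zero_iff`).

For boundary matrices this means: a `k`-simplex `σ` of `L` has a zero column in the reduced `BL` iff
it leads a cycle of `L`, and it is a pivot of the reduced `BL` at a column of index at most `i` iff
it leads an element of `B_k(L_i)`. In `BK` the rows of `L` come first, so a pivot in such a row
forces the whole column into `L`; the pivots in `L` are therefore the leading simplices of `B_k(K_i)
∩ C_k(L)` (`exists_pivot_iff`). This intersection equals `B_k(K_i) ∩ Z_k(L_i)`, the subspace to be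
divided out of `Z_k(L_i)` to obtain the image of `H_k(L_i)` in `H_k(K_i)`.

Barcodes: let `X` be `L` or `K`. For each birth simplex `σ` choose a cycle led by `σ` which, if
possible, is a boundary in `X` at the first index where `σ` leads such a boundary. By triangularity
the cycles born by `i` form a basis of `Z_k(L_i)`, and those dead by `i` a basis of `B_k(X_i) ∩
Z_k(L_i)`; the remaining classes give the interval decomposition (`isBarcode_of_isLead`,
`isBarcode_of_cycles`). Both barcodes are thus indexed by the same birth simplices, which provides
the matching, and `B_k(L_i) ⊆ B_k(K_i)` gives `d' ≤ d`. -/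

/-- `s` is the leading entry of `x`: all other entries in the support come strictly before it. -/
def IsLead {κ F : Type*} [Zero F] (ord : κ → ℕ) (x : κ → F) (s : κ) : Prop :=
  x s ≠ 0 ∧ ∀ t, x t ≠ 0 → t ≠ s → ord t < ord s

theorem IsLead.unique {κ F : Type*} [Zero F] {ord : κ → ℕ} {x : κ → F} {s t : κ}
    (hs : IsLead ord x s) (ht : IsLead ord x t) : s = t := by
  by_contra h
  exact lt_asymm (hs.2 t ht.1 (Ne.symm h)) (ht.2 s hs.1 h)

theorem IsLead.le {κ F : Type*} [Zero F] {ord : κ → ℕ} {x : κ → F} {s t : κ}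
    (hs : IsLead ord x s) (ht : x t ≠ 0) : ord t ≤ ord s := by
  by_cases h : t = s
  · rw [h]
  · exact (hs.2 t ht h).le

theorem exists_isLead_of_injOn {κ F : Type*} [Zero F] {ord : κ → ℕ} {x : κ →₀ F} (hx : x ≠ 0)
    (hord : Set.InjOn ord x.support) : ∃ s, IsLead ord x s := by
  obtain ⟨s, hs, hmax⟩ := Finset.exists_max_image x.support ord (Finsupp.support_nonempty_iff.2 hx)
  refine ⟨s, Finsupp.mem_support_iff.1 hs, fun t ht hts => ?_⟩
  exact lt_of_le_of_ne (hmax t (Finsupp.mem_support_iff.2 ht)) fun h =>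
    hts (hord (Finsupp.mem_support_iff.2 ht) hs h)

/-- The leading entry of a linear combination of vectors with distinct leading entries. -/
theorem exists_isLead_sum {ι κ F : Type*} [Field F] {ord : κ → ℕ} (T : Finset ι)
    (hT : T.Nonempty) (c : ι → F) (hc : ∀ l ∈ T, c l ≠ 0) (u : ι → κ → F) (p : ι → κ)
    (hu : ∀ l ∈ T, IsLead ord (u l) (p l)) (hp : Set.InjOn (fun l => ord (p l)) T) :
    ∃ l ∈ T, IsLead ord (∑ j ∈ T, c j • u j) (p l) := by
  -- The vector whose leading entry is greatest wins: every other vector vanishes at that position,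
  -- so nothing can cancel it.
  obtain ⟨l, hl, hmax⟩ := Finset.exists_max_image T (fun l => ord (p l)) hT
  refine ⟨l, hl, ?_, fun t ht htl => ?_⟩
  · rw [Finset.sum_apply, Finset.sum_eq_single_of_mem l hl]
    · exact mul_ne_zero (hc l hl) (hu l hl).1
    · intro j hj hjl
      by_contra h
      have h1 : u j (p l) ≠ 0 := fun h0 => h (by simp [h0])
      have h2 := (hu j hj).le h1
      exact hjl (hp hj hl (le_antisymm (hmax j hj) h2))
  · rw [Finset.sum_apply] at ht
    obtain ⟨j, hj, hne⟩ := Finset.exists_ne_zero_of_sum_ne_zero ht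
    have h1 : u j t ≠ 0 := fun h0 => hne (by simp [h0])
    by_cases htj : t = p j
    · subst htj
      have hjl : j ≠ l := fun h => htl (by rw [h])
      exact lt_of_le_of_ne (hmax j hj) fun h => hjl (hp hj hl h)
    · exact lt_of_lt_of_le ((hu j hj).2 t h1 htj) (hmax j hj)

/-- Membership in a span of vectors whose nonzero members have distinct leading entries. -/
theorem exists_isLead_of_mem_span {ι κ F : Type*} [Field F] {ord : κ → ℕ} {u : ι → κ → F}
    {s : Set ι} (hlead : ∀ l, u l ≠ 0 → ∃ p, IsLead ord (u l) p)
    (hdist : ∀ l l' p p', IsLead ord (u l) p → IsLead ord (u l') p' → ord p = ord p' → l = l')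
    {w : κ → F} (hw : w ∈ Submodule.span F (u '' s)) (hw0 : w ≠ 0) :
    ∃ l ∈ s, ∃ p, IsLead ord (u l) p ∧ IsLead ord w p := by
  classical
  obtain ⟨c, hc, rfl⟩ := (Finsupp.mem_span_image_iff_linearCombination F).1 hw
  -- Zero vectors, such as the zero columns of a reduced matrix, have no leading entry and are
  -- dropped from the combination.
  set T := c.support.filter fun l => u l ≠ 0 with hTdef
  have hsum : Finsupp.linearCombination F u c = ∑ l ∈ T, c l • u l := by
    rw [Finsupp.linearCombination_apply, Finsupp.sum, hTdef, Finset.sum_filter]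
    refine Finset.sum_congr rfl fun l _ => ?_
    split_ifs with h
    · rfl
    · rw [not_not.1 h, smul_zero]
  have hne : ∀ l ∈ T, u l ≠ 0 := fun l hl => (Finset.mem_filter.1 hl).2
  have hT : T.Nonempty := by
    rw [Finset.nonempty_iff_ne_empty]
    intro h
    rw [h, Finset.sum_empty] at hsum
    exact hw0 hsum
  obtain ⟨l0, hl0⟩ := hT
  have : Nonempty κ := (hlead l0 (hne l0 hl0)).nonempty
  choose! p hp using fun l (hl : l ∈ T) => hlead l (hne l hl)
  obtain ⟨l, hl, hlw⟩ := exists_isLead_sum (ord := ord) T ⟨l0, hl0⟩ c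
    (fun l hl => Finsupp.mem_support_iff.1 (Finset.mem_filter.1 hl).1) u p hp
    (fun a ha b hb h => hdist a b _ _ (hp a ha) (hp b hb) h)
  refine ⟨l, hc (Finset.mem_filter.1 hl).1, p l, hp l hl, ?_⟩
  rw [hsum]
  exact hlw

/-! ### Spans of triangularly equivalent families -/

theorem span_image_le_of_triangular {F E : Type*} [Ring F] [AddCommGroup E] [Module F E] {c : ℕ}
    {u v : Fin c → E} (h : ∀ j, u j - v j ∈ Submodule.span F (v '' Set.Iio j)) {s : Set (Fin c)}
    (hs : IsLowerSet s) : Submodule.span F (u '' s) ≤ Submodule.span F (v '' s) := by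
  rw [Submodule.span_le]
  rintro _ ⟨j, hj, rfl⟩
  have h1 := Submodule.span_mono (R := F)
    (Set.image_mono (f := v) fun i (hi : i ∈ Set.Iio j) => hs hi.le hj) (h j)
  have h2 : v j ∈ Submodule.span F (v '' s) := Submodule.subset_span ⟨j, hj, rfl⟩
  simpa using Submodule.add_mem _ h1 h2

/-- The inverse of a unitriangular change of family is unitriangular, by induction on the position.
Consequently both families span the same space on every initial segment. -/
theorem triangular_symm {F E : Type*} [Ring F] [AddCommGroup E] [Module F E] {c : ℕ}
    {u v : Fin c → E} (h : ∀ j, u j - v j ∈ Submodule.span F (v '' Set.Iio j)) (j : Fin c) :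
    v j - u j ∈ Submodule.span F (u '' Set.Iio j) := by
  induction j using WellFoundedLT.induction with
  | ind j ih =>
    have hle : Submodule.span F (v '' Set.Iio j) ≤ Submodule.span F (u '' Set.Iio j) := by
      rw [Submodule.span_le]
      rintro _ ⟨i, hi, rfl⟩
      have h1 := Submodule.span_mono (R := F)
        (Set.image_mono (f := u) (Set.Iio_subset_Iio (le_of_lt hi))) (ih i hi)
      have h2 : u i ∈ Submodule.span F (u '' Set.Iio j) := Submodule.subset_span ⟨i, hi, rfl⟩
      simpa using Submodule.add_mem _ h1 h2
    simpa using Submodule.neg_mem _ (hle (h j))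

theorem span_image_eq_of_triangular {F E : Type*} [Ring F] [AddCommGroup E] [Module F E] {c : ℕ}
    {u v : Fin c → E} (h : ∀ j, u j - v j ∈ Submodule.span F (v '' Set.Iio j)) {s : Set (Fin c)}
    (hs : IsLowerSet s) : Submodule.span F (u '' s) = Submodule.span F (v '' s) :=
  le_antisymm (span_image_le_of_triangular h hs)
    (span_image_le_of_triangular (triangular_symm h) hs)

/-! ### Correctness of the reduction -/

section ReductionCorrect

variable {m c : ℕ}

theorem pivot_eq_coe_iff {R : Matrix (Fin m) (Fin c) (ZMod 2)} {j : Fin c} {r : Fin m} :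
    pivot R j = (r : WithBot (Fin m)) ↔ IsLead Fin.val (R.col j) r := by
  constructor
  · intro h
    have h1 := Finset.mem_of_max h
    refine ⟨(Finset.mem_filter.1 h1).2, fun t ht hts => ?_⟩
    have h2 := Finset.le_max_of_eq (s := Finset.univ.filter fun i => R i j ≠ 0)
      (a := t) (Finset.mem_filter.2 ⟨Finset.mem_univ _, ht⟩) h
    exact lt_of_le_of_ne h2 fun h => hts (Fin.ext h)
  · rintro ⟨h1, h2⟩
    refine le_antisymm (Finset.max_le fun i hi => WithBot.coe_le_coe.2 ?_)
      (Finset.le_max (Finset.mem_filter.2 ⟨Finset.mem_univ _, h1⟩))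
    by_cases hir : i = r
    · exact hir.le
    · exact (h2 i (Finset.mem_filter.1 hi).2 hir).le

theorem exists_isLead_col {R : Matrix (Fin m) (Fin c) (ZMod 2)} {j : Fin c} (h : R.col j ≠ 0) :
    ∃ r, IsLead Fin.val (R.col j) r := by
  obtain ⟨i, hi⟩ := Function.ne_iff.1 h
  obtain ⟨r, hr⟩ := Finset.max_of_mem (s := Finset.univ.filter fun i => R i j ≠ 0) (a := i)
    (Finset.mem_filter.2 ⟨Finset.mem_univ _, hi⟩)
  exact ⟨r, pivot_eq_coe_iff.1 hr⟩

theorem pivot_congr {R R' : Matrix (Fin m) (Fin c) (ZMod 2)} {j : Fin c}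
    (h : R'.col j = R.col j) : pivot R' j = pivot R j := by
  have h' : ∀ i, R' i j = R i j := fun i => congrFun h i
  simp only [pivot, h']

theorem findConflict_eq_none_iff {R : Matrix (Fin m) (Fin c) (ZMod 2)} {j : Fin c} :
    findConflict R j = none ↔ ∀ l < j, pivot R j ≠ ⊥ → pivot R l ≠ pivot R j := by
  simp only [findConflict, List.find?_eq_none, List.mem_finRange, decide_eq_true_eq, true_implies]
  grind

/-- Invariants of the `while` loop, proved along its own recursion: only column `j` changes, and
only by columns to its left, which themselves stay fixed. The loop can stop only when no conflict is
left. -/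
theorem reduceColumn_spec (j : Fin c) (R : Matrix (Fin m) (Fin c) (ZMod 2)) :
    (∀ l, l ≠ j → (reduceColumn j R).col l = R.col l) ∧
      (reduceColumn j R).col j - R.col j ∈ Submodule.span (ZMod 2) (R.col '' Set.Iio j) ∧
      findConflict (reduceColumn j R) j = none := by
  induction R using reduceColumn.induct (j := j) with
  | case1 R l h ih =>
    rw [reduceColumn.eq_def]
    split
    · rename_i l' h'
      obtain rfl : l = l' := Option.some.inj (h.symm.trans h')
      have hlj : l < j := (of_decide_eq_true (List.find?_some
        (p := fun l => decide (l < j ∧ pivot R j ≠ ⊥ ∧ pivot R l = pivot R j)) h)).1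
      have hcol : ∀ i, i ≠ j → (R.updateCol j (R.col j + R.col l)).col i = R.col i := by
        intro i hi
        ext r
        simp [Matrix.col_apply, Matrix.updateCol_ne hi]
      have hcolj : (R.updateCol j (R.col j + R.col l)).col j = R.col j + R.col l := by
        ext r
        simp [Matrix.col_apply]
      obtain ⟨h1, h2, h3⟩ := ih
      refine ⟨fun i hi => (h1 i hi).trans (hcol i hi), ?_, h3⟩
      have himg : (R.updateCol j (R.col j + R.col l)).col '' Set.Iio j = R.col '' Set.Iio j :=
        Set.image_congr fun i hi => hcol i (ne_of_lt hi)
      rw [himg, hcolj] at h2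
      have h4 : R.col l ∈ Submodule.span (ZMod 2) (R.col '' Set.Iio j) :=
        Submodule.subset_span ⟨l, hlj, rfl⟩
      have h5 := Submodule.add_mem _ h2 h4
      convert h5 using 1
      abel
    · rename_i h'
      simp [h] at h'
  | case2 R h =>
    rw [reduceColumn.eq_def]
    split
    · rename_i l' h'
      simp [h] at h'
    · exact ⟨fun _ _ => rfl, by simp, h⟩

/-- Increasing order is what makes one pass sufficient: once column `j` is free of conflicts, the
later steps alter neither it nor any column to its left. -/
theorem foldl_reduceColumn_spec (l : List (Fin c)) (hl : l.Pairwise (· < ·))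
    (R : Matrix (Fin m) (Fin c) (ZMod 2)) :
    (∀ j, j ∉ l → (l.foldl (fun R j => reduceColumn j R) R).col j = R.col j) ∧
      (∀ j, (l.foldl (fun R j => reduceColumn j R) R).col j - R.col j ∈
        Submodule.span (ZMod 2) (R.col '' Set.Iio j)) ∧
      ∀ j ∈ l, findConflict (l.foldl (fun R j => reduceColumn j R) R) j = none := by
  induction l generalizing R with
  | nil => simp
  | cons a l ih =>
    obtain ⟨hal, hl⟩ := List.pairwise_cons.1 hl
    obtain ⟨h1, h2, h3⟩ := reduceColumn_spec a R
    obtain ⟨i1, i2, i3⟩ := ih hl (reduceColumn a R)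
    have htri : ∀ j, (reduceColumn a R).col j - R.col j ∈
        Submodule.span (ZMod 2) (R.col '' Set.Iio j) := by
      intro j
      by_cases hj : j = a
      · rw [hj]
        exact h2
      · simp [h1 j hj]
    simp only [List.foldl_cons]
    refine ⟨fun j hj => ?_, fun j => ?_, fun j hj => ?_⟩
    · rw [List.mem_cons, not_or] at hj
      rw [i1 j hj.2, h1 j hj.1]
    · have h := span_image_le_of_triangular htri (isLowerSet_Iio j) (i2 j)
      simpa using Submodule.add_mem _ h (htri j)
    · rcases List.mem_cons.1 hj with rfl | hj
      · have heq : ∀ i ≤ j, pivot (l.foldl (fun R j => reduceColumn j R) (reduceColumn j R)) i =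
            pivot (reduceColumn j R) i := fun i hi =>
          pivot_congr (i1 i fun hil => absurd (hal i hil) (not_lt.2 hi))
        rw [findConflict_eq_none_iff] at h3 ⊢
        intro i hi
        rw [heq j le_rfl, heq i hi.le]
        exact h3 i hi
      · exact i3 j hj

theorem reduceMatrix_triangular (M : Matrix (Fin m) (Fin c) (ZMod 2)) (j : Fin c) :
    (reduceMatrix M).col j - M.col j ∈ Submodule.span (ZMod 2) (M.col '' Set.Iio j) :=
  (foldl_reduceColumn_spec _ (List.pairwise_lt_finRange c) M).2.1 j

theorem reduceMatrix_lead_injective (M : Matrix (Fin m) (Fin c) (ZMod 2)) {j l : Fin c}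
    {r : Fin m} (hj : IsLead Fin.val ((reduceMatrix M).col j) r)
    (hl : IsLead Fin.val ((reduceMatrix M).col l) r) : j = l := by
  have key : ∀ j l, IsLead Fin.val ((reduceMatrix M).col j) r →
      IsLead Fin.val ((reduceMatrix M).col l) r → ¬ l < j := by
    intro j l hj hl hlt
    have h := findConflict_eq_none_iff.1
      ((foldl_reduceColumn_spec _ (List.pairwise_lt_finRange c) M).2.2 j (List.mem_finRange j))
    rw [← pivot_eq_coe_iff] at hj hl
    refine h l hlt ?_ (hl.trans hj.symm)
    change pivot (reduceMatrix M) j ≠ ⊥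
    rw [hj]
    exact WithBot.coe_ne_bot
  exact le_antisymm (not_lt.1 (key j l hj hl)) (not_lt.1 (key l j hl hj))

/-- Over an initial segment the original and the reduced columns have the same span, and distinct
pivots rule out cancellation of the greatest one. -/
theorem exists_reduceMatrix_lead {M : Matrix (Fin m) (Fin c) (ZMod 2)} {s : Set (Fin c)}
    (hs : IsLowerSet s) {w : Fin m → ZMod 2} (hw : w ∈ Submodule.span (ZMod 2) (M.col '' s))
    (hw0 : w ≠ 0) : ∃ l ∈ s, ∃ r, IsLead Fin.val ((reduceMatrix M).col l) r ∧
      IsLead Fin.val w r := by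
  rw [← span_image_eq_of_triangular (reduceMatrix_triangular M) hs] at hw
  refine exists_isLead_of_mem_span (fun l hl => exists_isLead_col hl) ?_ hw hw0
  intro l l' p p' h h' hpp
  obtain rfl := Fin.ext hpp
  exact reduceMatrix_lead_injective M h h'

theorem reduceMatrix_col_mem {M : Matrix (Fin m) (Fin c) (ZMod 2)} {s : Set (Fin c)}
    (hs : IsLowerSet s) {j : Fin c} (hj : j ∈ s) :
    (reduceMatrix M).col j ∈ Submodule.span (ZMod 2) (M.col '' s) := by
  rw [← span_image_eq_of_triangular (reduceMatrix_triangular M) hs]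
  exact Submodule.subset_span ⟨j, hj, rfl⟩

theorem reduceMatrix_col_eq_zero_iff {M : Matrix (Fin m) (Fin c) (ZMod 2)} {j : Fin c} :
    (reduceMatrix M).col j = 0 ↔ M.col j ∈ Submodule.span (ZMod 2) (M.col '' Set.Iio j) := by
  have h := reduceMatrix_triangular M j
  constructor
  · intro h0
    rw [h0, zero_sub] at h
    simpa using Submodule.neg_mem _ h
  · intro hM
    by_contra h0
    have hmem : (reduceMatrix M).col j ∈ Submodule.span (ZMod 2) (M.col '' Set.Iio j) := by
      simpa using Submodule.add_mem _ h hM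
    -- A nonzero reduced column spanned by earlier ones would share its pivot with an earlier
    -- reduced column.
    obtain ⟨l, hl, r, h1, h2⟩ := exists_reduceMatrix_lead (isLowerSet_Iio j) hmem h0
    exact (ne_of_lt hl) (reduceMatrix_lead_injective M h1 h2)

end ReductionCorrect
/-! ### Barcodes from leading entries -/

namespace PersistenceModule

variable {n : ℕ}

/-- The coordinates of an element of a direct sum of interval modules. -/
def intervalCoords {N : ℕ} (I : Fin N → ℕ × ℕ) (i : Set.Icc 1 n) :
    (directSum fun j => interval n (I j).1 (I j).2).obj i →ₗ[ZMod 2] (Fin N → ZMod 2) :=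
  LinearMap.pi fun j => Submodule.subtype
    (if (i : ℕ) ∈ Set.Ico (I j).1 (I j).2 then ⊤ else ⊥ : Submodule (ZMod 2) (ZMod 2)) ∘ₗ
      LinearMap.proj j

theorem intervalCoords_injective {N : ℕ} (I : Fin N → ℕ × ℕ) (i : Set.Icc 1 n) :
    Function.Injective (intervalCoords I i) := by
  intro x y h
  funext j
  exact Subtype.ext (congrFun h j)

theorem intervalCoords_eq_zero {N : ℕ} (I : Fin N → ℕ × ℕ) (i : Set.Icc 1 n)
    (x : (directSum fun j => interval n (I j).1 (I j).2).obj i) (j : Fin N)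
    (hj : (i : ℕ) ∉ Set.Ico (I j).1 (I j).2) : intervalCoords I i x j = 0 := by
  have h : intervalCoords I i x j ∈
      (if (i : ℕ) ∈ Set.Ico (I j).1 (I j).2 then ⊤ else ⊥ : Submodule (ZMod 2) (ZMod 2)) :=
    Subtype.property (x j)
  rwa [if_neg hj, Submodule.mem_bot] at h

theorem exists_intervalCoords_eq {N : ℕ} (I : Fin N → ℕ × ℕ) (i : Set.Icc 1 n)
    (y : Fin N → ZMod 2) (hy : ∀ j, (i : ℕ) ∉ Set.Ico (I j).1 (I j).2 → y j = 0) :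
    ∃ x, intervalCoords I i x = y := by
  refine ⟨fun j => (⟨y j, ?_⟩ : ↥(if (i : ℕ) ∈ Set.Ico (I j).1 (I j).2 then ⊤ else ⊥ :
    Submodule (ZMod 2) (ZMod 2))), rfl⟩
  split_ifs with h
  · trivial
  · exact hy j h

theorem intervalCoords_map {N : ℕ} (I : Fin N → ℕ × ℕ) {i i' : Set.Icc 1 n} (h : i ≤ i')
    (x : (directSum fun j => interval n (I j).1 (I j).2).obj i) (j : Fin N) :
    intervalCoords I i' ((directSum fun j => interval n (I j).1 (I j).2).map h x) j =
      if (i' : ℕ) ∈ Set.Ico (I j).1 (I j).2 then intervalCoords I i x j else 0 := by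
  change ((if (i' : ℕ) ∈ Set.Ico (I j).1 (I j).2 then LinearMap.id else 0 :
    ZMod 2 →ₗ[ZMod 2] ZMod 2)) (intervalCoords I i x j) = _
  split_ifs <;> rfl

/-- A presentation of a persistence module by subspaces `A i` of a space with a basis, together with
a family of vectors with distinct leading entries which are compatible with the generators and the
relations, determines a barcode. -/
theorem isBarcode_of_isLead {κ : Type*} (M : PersistenceModule n) (ord : κ → ℕ)
    (A : Set.Icc 1 n → Submodule (ZMod 2) (κ →₀ ZMod 2)) (hmono : ∀ {i j}, i ≤ j → A i ≤ A j)
    (q : ∀ i, A i →ₗ[ZMod 2] M.obj i) (hsurj : ∀ i, Function.Surjective (q i))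
    (hnat : ∀ {i j} (h : i ≤ j) (x : A i),
      M.map h (q i x) = q j (Submodule.inclusion (hmono h) x))
    (hord : ∀ i, ∀ x ∈ A i, Set.InjOn ord x.support)
    {N : ℕ} (σ : Fin N → κ) (z : Fin N → κ →₀ ZMod 2) (I : Fin N → ℕ × ℕ)
    (hI : ∀ j, 1 ≤ (I j).1 ∧ (I j).1 < (I j).2 ∧ (I j).2 ≤ n + 1)
    (hσ : Function.Injective fun j => ord (σ j)) (hz : ∀ j, IsLead ord (z j) (σ j))
    (hzA : ∀ (i : Set.Icc 1 n) j, (I j).1 ≤ (i : ℕ) → z j ∈ A i)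
    (hz0 : ∀ (i : Set.Icc 1 n) j (h : z j ∈ A i), (I j).2 ≤ (i : ℕ) → q i ⟨z j, h⟩ = 0)
    (hA : ∀ i : Set.Icc 1 n, ∀ x ∈ A i, ∀ s, IsLead ord x s → ∃ j, s = σ j ∧ (I j).1 ≤ (i : ℕ))
    (hB : ∀ (i : Set.Icc 1 n) (x : A i), q i x = 0 → ∀ s, IsLead ord (x : κ →₀ ZMod 2) s →
      ∃ j, s = σ j ∧ (I j).2 ≤ (i : ℕ)) :
    M.IsBarcode (Finset.univ.val.map I) := by
  refine ⟨fun J hJ => ?_, N, I, rfl, ?_⟩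
  · obtain ⟨j, -, rfl⟩ := Multiset.mem_map.1 hJ
    exact hI j
  set D := directSum fun j => interval n (I j).1 (I j).2
  set comb : (Fin N → ZMod 2) →ₗ[ZMod 2] (κ →₀ ZMod 2) := Fintype.linearCombination (ZMod 2) z
  have hcomb : ∀ y, comb y = ∑ j, y j • z j := fun y => Fintype.linearCombination_apply _ _ _
  have hmem : ∀ (i : Set.Icc 1 n) (y : Fin N → ZMod 2), (∀ j, (I j).1 ≤ (i : ℕ) ∨ y j = 0) → comb y ∈ A i := by
    intro i y hy
    rw [hcomb]
    refine Submodule.sum_mem _ fun j _ => ?_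
    rcases hy j with h | h
    · exact Submodule.smul_mem _ _ (hzA i j h)
    · rw [h, zero_smul]
      exact Submodule.zero_mem _
  have hcoord : ∀ (i : Set.Icc 1 n) (x : D.obj i) j, (I j).1 ≤ (i : ℕ) ∨ intervalCoords I i x j = 0 := by
    intro i x j
    by_cases h : (I j).1 ≤ (i : ℕ)
    · exact Or.inl h
    · exact Or.inr (intervalCoords_eq_zero I i x j fun h' => h h'.1)
  -- The generator of the `j`-th interval goes to the class of `z j`; this will be the inverse of
  -- the required isomorphism.
  let Φ : ∀ i, D.obj i →ₗ[ZMod 2] M.obj i := fun i =>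
    q i ∘ₗ LinearMap.codRestrict (A i) (comb ∘ₗ intervalCoords I i)
      fun x => hmem i _ (hcoord i x)
  have hΦ : ∀ i (x : D.obj i), Φ i x = q i ⟨comb (intervalCoords I i x), hmem i _ (hcoord i x)⟩ :=
    fun i x => rfl
  have hkill : ∀ (i : Set.Icc 1 n) (y : Fin N → ZMod 2) (h : comb y ∈ A i),
      (∀ j, (I j).2 ≤ (i : ℕ) ∨ y j = 0) → q i ⟨comb y, h⟩ = 0 := by
    intro i y h hy
    have hle : (LinearMap.ker (q i)).map (A i).subtype ≤ A i := Submodule.map_subtype_le _ _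
    have hmemk : comb y ∈ (LinearMap.ker (q i)).map (A i).subtype := by
      rw [hcomb]
      refine Submodule.sum_mem _ fun j _ => ?_
      rcases hy j with h | h
      · have hzj := hzA i j ((hI j).2.1.le.trans h)
        exact Submodule.smul_mem _ _ ⟨⟨z j, hzj⟩, hz0 i j hzj h, rfl⟩
      · rw [h, zero_smul]
        exact Submodule.zero_mem _
    obtain ⟨x, hx, hxy⟩ := hmemk
    have : x = ⟨comb y, h⟩ := Subtype.ext hxy
    rw [← this]
    exact hx
  -- A nontrivial relation would have some `σ l` as its leading entry, with nonzero coefficient. By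
  -- `hB` the `l`-th interval has then ended, although only intervals alive at `i` carry
  -- coefficients.
  have hinj : ∀ i, Function.Injective (Φ i) := by
    intro i
    rw [← LinearMap.ker_eq_bot, Submodule.eq_bot_iff]
    intro x hx
    by_contra hx0
    set y := intervalCoords I i x with hy
    have hy0 : y ≠ 0 := fun h =>
      hx0 (intervalCoords_injective I i (h.trans (map_zero _).symm))
    obtain ⟨j0, hj0⟩ := Function.ne_iff.1 hy0
    obtain ⟨l, hl, hlead⟩ := exists_isLead_sum (ord := ord) (Finset.univ.filter fun j => y j ≠ 0)
      ⟨j0, by simpa using hj0⟩ y (fun l hl => (Finset.mem_filter.1 hl).2) (fun j => ⇑(z j)) σ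
      (fun l _ => hz l) hσ.injOn
    have hsum : ⇑(comb y) = ∑ j ∈ Finset.univ.filter (fun j => y j ≠ 0), y j • ⇑(z j) := by
      rw [hcomb, Finset.sum_filter]
      ext t
      simp only [Finsupp.coe_finsetSum, Finset.sum_apply, Finsupp.coe_smul, Pi.smul_apply]
      refine Finset.sum_congr rfl fun j _ => ?_
      split_ifs with h
      · rfl
      · rw [not_not.1 h]
        simp
    rw [← hsum] at hlead
    obtain ⟨j, hj, hji⟩ := hB i ⟨comb y, hmem i _ (hcoord i x)⟩ hx _ hlead
    obtain rfl : l = j := hσ (congrArg ord hj)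
    refine (Finset.mem_filter.1 hl).2 (intervalCoords_eq_zero I i x l fun h => ?_)
    exact absurd h.2 (not_lt.2 hji)
  -- Elimination by induction on a strict bound for the order of the leading entry: over `ℤ/2`,
  -- subtracting the `z j` with the same leading entry cancels it.
  have hrange : ∀ i (m : ℕ), ∀ x (hx : x ∈ A i), (∀ s, IsLead ord x s → ord s < m) →
      q i ⟨x, hx⟩ ∈ LinearMap.range (Φ i) := by
    intro i m
    induction m with
    | zero =>
      intro x hx h
      have hx0 : x = 0 := by
        by_contra hne
        obtain ⟨s, hs⟩ := exists_isLead_of_injOn hne (hord i x hx)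
        exact absurd (h s hs) (Nat.not_lt_zero _)
      subst hx0
      have : q i ⟨0, hx⟩ = 0 := map_zero (q i)
      rw [this]
      exact Submodule.zero_mem _
    | succ m ih =>
      intro x hx h
      by_cases hne : x = 0
      · exact ih x hx fun s hs => absurd (by simp [hne]) hs.1
      obtain ⟨s, hs⟩ := exists_isLead_of_injOn hne (hord i x hx)
      obtain ⟨j, rfl, hj⟩ := hA i x hx s hs
      have hzj := hzA i j hj
      have hlt : ∀ t, (x - z j) t ≠ 0 → ord t < ord (σ j) := by
        intro t ht
        have hts : t ≠ σ j := by
          rintro rfl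
          have key : ∀ a b : ZMod 2, a ≠ 0 → b ≠ 0 → a - b = 0 := by decide
          exact ht (key _ _ hs.1 (hz j).1)
        by_cases hxt : x t = 0
        · exact (hz j).2 t (fun h0 => ht (by simp [hxt, h0])) hts
        · exact hs.2 t hxt hts
      have h1 := ih (x - z j) (Submodule.sub_mem _ hx hzj) fun s' hs' =>
        lt_of_lt_of_le (hlt s' hs'.1) (Nat.lt_succ_iff.1 (h _ hs))
      have h2 : q i ⟨z j, hzj⟩ ∈ LinearMap.range (Φ i) := by
        by_cases hd : (I j).2 ≤ (i : ℕ)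
        · rw [hz0 i j hzj hd]
          exact Submodule.zero_mem _
        · obtain ⟨e, he⟩ := exists_intervalCoords_eq (n := n) I i (Pi.single j 1) (by
            intro l hl
            refine Pi.single_eq_of_ne ?_ _
            rintro rfl
            exact hl ⟨hj, not_le.1 hd⟩)
          refine ⟨e, ?_⟩
          rw [hΦ]
          congr 1
          ext1
          change comb (intervalCoords I i e) = z j
          rw [he]
          simp [comb]
      have h3 := Submodule.add_mem _ h1 h2
      rw [← map_add] at h3
      convert h3 using 2
      ext1
      simp
  have hbij : ∀ i, Function.Bijective (Φ i) := by
    refine fun i => ⟨hinj i, fun w => ?_⟩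
    obtain ⟨⟨x, hx⟩, rfl⟩ := hsurj i w
    by_cases hne : x = 0
    · exact hrange i 0 x hx fun s hs => absurd (by simp [hne]) hs.1
    obtain ⟨s, hs⟩ := exists_isLead_of_injOn hne (hord i x hx)
    refine hrange i (ord s + 1) x hx fun t ht => ?_
    rw [ht.unique hs]
    exact Nat.lt_succ_self _
  have hnatΦ : ∀ {i i' : Set.Icc 1 n} (h : i ≤ i') (x : D.obj i),
      M.map h (Φ i x) = Φ i' (D.map h x) := by
    intro i i' h x
    rw [hΦ, hΦ, hnat h, ← sub_eq_zero, ← map_sub]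
    have hy : comb (intervalCoords I i x - intervalCoords I i' (D.map h x)) ∈ A i' := by
      rw [map_sub]
      exact Submodule.sub_mem _ (hmono h (hmem i _ (hcoord i x))) (hmem i' _ (hcoord i' _))
    -- Moving from `i` to `i'` discards just the coordinates whose intervals have ended, and their
    -- vectors have class zero at `i'`.
    have h0 := hkill i' _ hy (by
      intro j
      rw [Pi.sub_apply, intervalCoords_map I h x j]
      by_cases hj : (I j).2 ≤ (i' : ℕ)
      · exact Or.inl hj
      · right
        split_ifs with hmemI
        · exact sub_self _
        · rw [sub_zero]
          refine intervalCoords_eq_zero I i x j fun hji => hmemI ⟨hji.1.trans h, not_le.1 hj⟩)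
    convert h0 using 2
    ext1
    simp
  refine ⟨⟨fun i => (LinearEquiv.ofBijective (Φ i) (hbij i)).symm, fun {i i'} h => ?_⟩⟩
  refine LinearMap.ext fun w => ?_
  obtain ⟨x, rfl⟩ := (hbij i).2 w
  have e1 : (LinearEquiv.ofBijective (Φ i) (hbij i)).symm (Φ i x) = x :=
    LinearEquiv.ofBijective_symm_apply_apply _ _
  have e2 : (LinearEquiv.ofBijective (Φ i') (hbij i')).symm (Φ i' (D.map h x)) = D.map h x :=
    LinearEquiv.ofBijective_symm_apply_apply _ _
  simp only [LinearMap.comp_apply, LinearEquiv.coe_coe]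
  rw [e1, hnatΦ h x, e2]

end PersistenceModule
/-! ### Filtrations and their lists of simplices -/

namespace SimplexwiseFiltration

variable {V : Type*} {n : ℕ}

theorem complex_le_total (K : SimplexwiseFiltration V n) (i : ℕ) : K.complex i ≤ K.total := by
  rcases le_total i n with h | h
  · exact K.mono h
  · exact (K.stationary i h).le

theorem mem_index {K : SimplexwiseFiltration V n} {σ : Finset V} (h : σ ∈ K.total) :
    σ ∈ K.complex (K.index σ) :=
  Nat.sInf_mem (s := {i | σ ∈ K.complex i}) ⟨n, h⟩

theorem index_le_of_mem {K : SimplexwiseFiltration V n} {σ : Finset V} {i : ℕ}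
    (h : σ ∈ K.complex i) : K.index σ ≤ i :=
  Nat.sInf_le h

theorem index_le {K : SimplexwiseFiltration V n} {σ : Finset V} (h : σ ∈ K.total) :
    K.index σ ≤ n :=
  index_le_of_mem h

theorem index_pos {K : SimplexwiseFiltration V n} {σ : Finset V} (h : σ ∈ K.total) :
    1 ≤ K.index σ := by
  rw [Nat.one_le_iff_ne_zero]
  intro h0
  have h1 := mem_index h
  rw [h0, K.complex_zero] at h1
  exact h1

theorem mem_complex_iff_index_le {K : SimplexwiseFiltration V n} {σ : Finset V} {i : ℕ} :
    σ ∈ K.complex i ↔ σ ∈ K.total ∧ K.index σ ≤ i :=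
  ⟨fun h => ⟨K.complex_le_total i h, index_le_of_mem h⟩, fun h => K.mono h.2 (mem_index h.1)⟩

theorem not_mem_of_lt_index {K : SimplexwiseFiltration V n} {σ : Finset V} {i : ℕ}
    (h : i < K.index σ) : σ ∉ K.complex i :=
  fun hm => absurd (index_le_of_mem hm) (not_le.2 h)

theorem index_injOn (K : SimplexwiseFiltration V n) : Set.InjOn K.index {σ | σ ∈ K.total} := by
  intro σ hσ τ hτ h
  have h1 := index_pos hσ
  obtain ⟨i, hi⟩ : ∃ i, K.index σ = i + 1 := ⟨K.index σ - 1, by omega⟩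
  have hσ1 := mem_index hσ
  have hτ1 := mem_index hτ
  rw [← h, hi] at hτ1
  rw [hi] at hσ1
  exact K.simplexwise i ⟨hσ1, not_mem_of_lt_index (by omega)⟩
    ⟨hτ1, not_mem_of_lt_index (by omega)⟩

theorem simplexAt_eq_some_iff {K : SimplexwiseFiltration V n} {i : ℕ} {σ : Finset V} :
    K.simplexAt i = some σ ↔ σ ∈ K.total ∧ K.index σ = i := by
  have key : ∀ τ, (τ ∈ K.complex i ∧ τ ∉ K.complex (i - 1)) ↔ (τ ∈ K.total ∧ K.index τ = i) := by
    intro τ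
    constructor
    · rintro ⟨h1, h2⟩
      have h3 := mem_complex_iff_index_le.1 h1
      refine ⟨h3.1, le_antisymm h3.2 ?_⟩
      by_contra hlt
      exact h2 (mem_complex_iff_index_le.2 ⟨h3.1, by omega⟩)
    · rintro ⟨h1, rfl⟩
      have := index_pos h1
      exact ⟨mem_index h1, not_mem_of_lt_index (by omega)⟩
  unfold simplexAt
  split_ifs with h
  · have hc := (key _).1 h.choose_spec
    rw [Option.some_inj]
    constructor
    · rintro rfl
      exact hc
    · intro hσ
      exact K.index_injOn hc.1 hσ.1 (hc.2.trans hσ.2.symm)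
  · simp only [false_iff]
    exact fun hσ => h ⟨σ, (key σ).2 hσ⟩

theorem mem_simplices {K : SimplexwiseFiltration V n} {σ : Finset V} :
    σ ∈ K.simplices ↔ σ ∈ K.total := by
  simp only [simplices, List.mem_filterMap, simplexAt_eq_some_iff, List.mem_range'_1]
  constructor
  · rintro ⟨i, -, h, -⟩
    exact h
  · intro h
    have h1 := index_pos h
    have h2 := index_le h
    exact ⟨K.index σ, ⟨h1, by omega⟩, h, rfl⟩

theorem pairwise_simplices (K : SimplexwiseFiltration V n) :
    K.simplices.Pairwise fun σ τ => K.index σ < K.index τ := by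
  rw [simplices, List.pairwise_filterMap]
  refine List.Pairwise.imp ?_ List.pairwise_lt_range'
  intro a b hab σ hσ τ hτ
  rw [(simplexAt_eq_some_iff.1 hσ).2, (simplexAt_eq_some_iff.1 hτ).2]
  exact hab

/-- Allows statements about a filtered subcomplex `X` of `K` to be used for `X = K` as well as for
`X = L`. -/
theorem isFilteredSubcomplex_self (K : SimplexwiseFiltration V n) : K.IsFilteredSubcomplex K :=
  ⟨fun _ => le_rfl, fun _ _ _ h => h⟩

/-- A simplex of `L` cannot be present in `K` before it enters `L`. So `L` carries the filtration
restricted from `K`, and a single index function suffices. -/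
theorem IsFilteredSubcomplex.mem_complex_iff {L K : SimplexwiseFiltration V n}
    (h : L.IsFilteredSubcomplex K) {σ : Finset V} {i : ℕ} :
    σ ∈ L.complex i ↔ σ ∈ L.total ∧ K.index σ ≤ i := by
  constructor
  · exact fun hσ => ⟨L.complex_le_total i hσ, index_le_of_mem (h.le i hσ)⟩
  · rintro ⟨hσ, hi⟩
    refine L.mono ?_ (mem_index hσ)
    have h1 := index_pos hσ
    obtain ⟨j, hj⟩ : ∃ j, L.index σ = j + 1 := ⟨L.index σ - 1, by omega⟩
    have h2 := mem_index hσ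
    rw [hj] at h2
    have h3 := h.not_mem_of_enters j σ h2 (not_mem_of_lt_index (by omega))
    by_contra hlt
    exact h3 (mem_complex_iff_index_le.2 ⟨h.le n hσ, by omega⟩)

theorem IsFilteredSubcomplex.total_le {L K : SimplexwiseFiltration V n}
    (h : L.IsFilteredSubcomplex K) : L.total ≤ K.total :=
  h.le n

end SimplexwiseFiltration

/-! ### The labels of the rows and columns and their order -/

section Lists

variable {V : Type*} {n : ℕ} {K : SimplexwiseFiltration V n} {k : ℕ}

theorem mem_mixupCols {σ : Finset V} :
    σ ∈ mixupCols K.simplices k ↔ σ ∈ K.total ∧ (σ.card = k + 1 ∨ σ.card = k + 2) := by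
  simp [mixupCols, SimplexwiseFiltration.mem_simplices]

theorem mixupCols_index_strictMono :
    StrictMono fun j => K.index ((mixupCols K.simplices k).get j) := by
  intro i j hij
  exact List.pairwise_iff_get.1 (K.pairwise_simplices.filter _) i j hij

theorem mem_mixupRows {inL : Finset V → Bool} {σ : Finset V} :
    σ ∈ mixupRows K.simplices inL k ↔ σ ∈ K.total ∧ (σ.card = k ∨ σ.card = k + 1) := by
  simp only [mixupRows, List.mem_append, List.mem_filter, SimplexwiseFiltration.mem_simplices,
    decide_eq_true_eq, Bool.not_eq_true']
  cases inL σ <;> simp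

/-- The rows that precede the row of a simplex of `L` belong to simplices of `L` of smaller index. -/
theorem mixupRows_of_lt {inL : Finset V → Bool} {r s : Fin (mixupRows K.simplices inL k).length}
    (hrs : r < s) (hs : inL ((mixupRows K.simplices inL k).get s) = true) :
    inL ((mixupRows K.simplices inL k).get r) = true ∧
      K.index ((mixupRows K.simplices inL k).get r) <
        K.index ((mixupRows K.simplices inL k).get s) := by
  have h : (mixupRows K.simplices inL k).Pairwise fun σ τ =>
      inL τ = true → inL σ = true ∧ K.index σ < K.index τ := by
    rw [mixupRows, List.pairwise_append]
    have hp := K.pairwise_simplices.filter fun σ => decide (σ.card = k ∨ σ.card = k + 1)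
    refine ⟨?_, ?_, ?_⟩
    · refine (hp.filter _).imp_of_mem ?_
      intro a b ha _ hab _
      exact ⟨(List.mem_filter.1 ha).2, hab⟩
    · refine (hp.filter _).imp_of_mem ?_
      intro a b _ hb _ hb'
      have := (List.mem_filter.1 hb).2
      simp [hb'] at this
    · intro a _ b hb hb'
      have := (List.mem_filter.1 hb).2
      simp [hb'] at this
  exact List.pairwise_iff_get.1 h r s hrs hs

end Lists

/-! ### The boundary operator -/

section Boundary

variable {V : Type*} [DecidableEq V]

theorem simplicialBoundary_single (τ : Finset V) (a : ZMod 2) :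
    simplicialBoundary V (Finsupp.single τ a) =
      a • (if 2 ≤ τ.card then ∑ v ∈ τ, Finsupp.single (τ.erase v) 1 else 0) := by
  simp [simplicialBoundary]

theorem simplicialBoundary_single_apply (τ ρ : Finset V) (a : ZMod 2) :
    simplicialBoundary V (Finsupp.single τ a) ρ =
      if ρ ⊆ τ ∧ ρ.card + 1 = τ.card ∧ 2 ≤ τ.card then a else 0 := by
  rw [simplicialBoundary_single]
  by_cases h2 : 2 ≤ τ.card
  · rw [if_pos h2, Finsupp.smul_apply, Finsupp.finsetSum_apply]
    by_cases h : ρ ⊆ τ ∧ ρ.card + 1 = τ.card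
    · rw [if_pos ⟨h.1, h.2, h2⟩]
      obtain ⟨v, hv, rfl⟩ : ∃ v ∈ τ, τ.erase v = ρ := by
        have hc : (τ \ ρ).card = 1 := by
          rw [Finset.card_sdiff_of_subset h.1]
          omega
        obtain ⟨v, hv⟩ := Finset.card_eq_one.1 hc
        refine ⟨v, (Finset.mem_sdiff.1 (hv ▸ Finset.mem_singleton_self v)).1, ?_⟩
        rw [← Finset.sdiff_singleton_eq_erase, ← hv, Finset.sdiff_sdiff_eq_self h.1]
      rw [Finset.sum_eq_single_of_mem v hv]
      · simp
      · intro w hw hwv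
        refine Finsupp.single_eq_of_ne fun he => hwv ?_
        exact Finset.erase_injOn τ hw hv he.symm
    · rw [if_neg fun h' => h ⟨h'.1, h'.2.1⟩, Finset.sum_eq_zero, smul_zero]
      intro v hv
      refine Finsupp.single_eq_of_ne ?_
      rintro rfl
      exact h ⟨Finset.erase_subset _ _, Finset.card_erase_add_one hv⟩
  · simp [h2]

theorem simplicialBoundary_apply (c : Finset V →₀ ZMod 2) (ρ : Finset V) :
    simplicialBoundary V c ρ =
      c.sum fun τ a => if ρ ⊆ τ ∧ ρ.card + 1 = τ.card ∧ 2 ≤ τ.card then a else 0 := by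
  induction c using Finsupp.induction_linear with
  | zero => simp
  | add f g hf hg =>
    rw [map_add, Finsupp.add_apply, hf, hg, Finsupp.sum_add_index']
    · intro τ
      simp
    · intro τ a b
      split_ifs <;> simp
  | single τ a => rw [simplicialBoundary_single_apply, Finsupp.sum_single_index (by simp)]

theorem exists_coface_of_boundary_ne_zero {c : Finset V →₀ ZMod 2} {ρ : Finset V}
    (h : simplicialBoundary V c ρ ≠ 0) :
    ∃ τ, c τ ≠ 0 ∧ ρ ⊆ τ ∧ ρ.card + 1 = τ.card ∧ 2 ≤ τ.card := by
  rw [simplicialBoundary_apply] at h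
  obtain ⟨τ, hτ, hne⟩ := Finset.exists_ne_zero_of_sum_ne_zero h
  refine ⟨τ, Finsupp.mem_support_iff.1 hτ, ?_⟩
  by_contra h'
  exact hne (if_neg h')

/-- The boundary lowers the degree by one. This separates the two degrees occurring among the
columns of one matrix. -/
theorem simplicialBoundary_filter_apply (c : Finset V →₀ ZMod 2) (m : ℕ) (ρ : Finset V) :
    simplicialBoundary V (c.filter fun τ => τ.card = m + 1) ρ =
      if ρ.card = m then simplicialBoundary V c ρ else 0 := by
  induction c using Finsupp.induction_linear with
  | zero => rw [Finsupp.filter_zero, map_zero, Finsupp.zero_apply, ite_self]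
  | add f g hf hg =>
    rw [Finsupp.filter_add, map_add, Finsupp.add_apply, hf, hg, map_add, Finsupp.add_apply]
    split_ifs <;> simp
  | single τ a =>
    by_cases h : τ.card = m + 1
    · rw [Finsupp.filter_single_of_pos (fun τ : Finset V => τ.card = m + 1) h]
      rw [simplicialBoundary_single_apply]
      split_ifs with h1 h2 <;> first | rfl | omega
    · rw [Finsupp.filter_single_of_neg (fun τ : Finset V => τ.card = m + 1) h]
      rw [simplicialBoundary_single_apply]
      split_ifs with h1 h2 <;> first | (exfalso; omega) | simp

theorem simplicialBoundary_boundary (c : Finset V →₀ ZMod 2) :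
    simplicialBoundary V (simplicialBoundary V c) = 0 := by
  induction c using Finsupp.induction_linear with
  | zero => simp
  | add f g hf hg => rw [map_add, map_add, hf, hg, add_zero]
  | single τ a =>
    rw [simplicialBoundary_single, map_smul]
    refine smul_eq_zero_of_right a ?_
    split_ifs with h2
    swap
    · simp
    rw [map_sum]
    by_cases h3 : 3 ≤ τ.card
    · have hterm : ∀ v ∈ τ, simplicialBoundary V (Finsupp.single (τ.erase v) 1) =
          ∑ w ∈ τ.erase v, Finsupp.single ((τ.erase v).erase w) (1 : ZMod 2) := by
        intro v hv
        rw [simplicialBoundary_single, one_smul, if_pos]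
        rw [Finset.card_erase_of_mem hv]
        omega
      rw [Finset.sum_congr rfl hterm, Finset.sum_sigma']
      -- Each face of codimension two arises twice, by removing its two missing vertices in either
      -- order, and the two terms cancel modulo 2.
      refine Finset.sum_involution (fun p _ => ⟨p.2, p.1⟩) ?_ ?_ ?_ ?_
      · rintro ⟨v, w⟩ _
        dsimp only
        rw [Finset.erase_right_comm]
        exact ZModModule.add_self _
      · rintro ⟨v, w⟩ hp _ he
        rw [Finset.mem_sigma, Finset.mem_erase] at hp
        exact hp.2.1 (congrArg Sigma.fst he)
      · rintro ⟨v, w⟩ hp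
        simp only [Finset.mem_sigma, Finset.mem_erase] at hp ⊢
        exact ⟨hp.2.2, Ne.symm hp.2.1, hp.1⟩
      · rintro ⟨v, w⟩ _
        rfl
    -- Here `τ` is an edge, whose facets are vertices; their boundary is zero by convention.
    · refine Finset.sum_eq_zero fun v hv => ?_
      rw [simplicialBoundary_single, if_neg, smul_zero]
      rw [Finset.card_erase_of_mem hv]
      omega

end Boundary
/-! ### The columns of the algorithm and homology -/

theorem PreAbstractSimplicialComplex.mem_of_subset {V : Type*} {X : PreAbstractSimplicialComplex V}
    {σ τ : Finset V} (hτ : τ ∈ X) (h : σ ⊆ τ) (hσ : σ.Nonempty) : σ ∈ X :=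
  (X.isRelLowerSet_faces hτ).2 h hσ

theorem PreAbstractSimplicialComplex.nonempty_of_mem {V : Type*} {X : PreAbstractSimplicialComplex V}
    {σ : Finset V} (hσ : σ ∈ X) : σ.Nonempty :=
  (X.isRelLowerSet_faces hσ).1

section Chains

variable {V : Type*} {n : ℕ}

theorem mem_simplicialChains {X : PreAbstractSimplicialComplex V} {k : ℕ}
    {x : Finset V →₀ ZMod 2} :
    x ∈ simplicialChains X k ↔ ∀ σ, x σ ≠ 0 → σ ∈ X ∧ σ.card = k + 1 := by
  rw [simplicialChains, Finsupp.mem_supported]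
  exact ⟨fun h σ hσ => h (Finsupp.mem_support_iff.2 hσ),
    fun h σ hσ => h σ (Finsupp.mem_support_iff.1 hσ)⟩

/-- The coefficients of a chain at the simplices of a list. -/
noncomputable def chainEntries (rows : List (Finset V)) :
    (Finset V →₀ ZMod 2) →ₗ[ZMod 2] (Fin rows.length → ZMod 2) :=
  LinearMap.pi fun r => Finsupp.lapply (rows.get r)

theorem chainEntries_apply (rows : List (Finset V)) (x : Finset V →₀ ZMod 2)
    (r : Fin rows.length) : chainEntries rows x r = x (rows.get r) := rfl

/-- The chains in degrees `k` and `k + 1` of the simplices of `X` of index less than `m`. -/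
noncomputable def mixupChains (K X : SimplexwiseFiltration V n) (k m : ℕ) :
    Submodule (ZMod 2) (Finset V →₀ ZMod 2) :=
  Finsupp.supported (ZMod 2) (ZMod 2)
    {σ | σ ∈ X.total ∧ K.index σ < m ∧ (σ.card = k + 1 ∨ σ.card = k + 2)}

variable {K X : SimplexwiseFiltration V n} {k : ℕ}

theorem filter_mem_simplicialChains (hXK : X.IsFilteredSubcomplex K) {l i : ℕ}
    {c : Finset V →₀ ZMod 2} (hc : c ∈ mixupChains K X k (i + 1)) :
    c.filter (fun τ => τ.card = l + 1) ∈ simplicialChains (X.complex i) l := by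
  rw [mem_simplicialChains]
  intro τ hτ
  have h1 : τ.card = l + 1 := by
    by_contra h
    exact hτ (Finsupp.filter_apply_neg _ _ h)
  rw [Finsupp.filter_apply_pos (fun τ : Finset V => τ.card = l + 1) _ h1] at hτ
  have h2 := (Finsupp.mem_supported _ _).1 hc (Finsupp.mem_support_iff.2 hτ)
  exact ⟨hXK.mem_complex_iff.2 ⟨h2.1, Nat.lt_succ_iff.1 h2.2.1⟩, h1⟩

theorem simplicialChains_le_mixupChains (hXK : X.IsFilteredSubcomplex K) {l i : ℕ}
    (hl : l = k ∨ l = k + 1) :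
    simplicialChains (X.complex i) l ≤ mixupChains K X k (i + 1) := by
  refine Finsupp.supported_mono fun τ hτ => ?_
  have h := hXK.mem_complex_iff.1 hτ.1
  refine ⟨h.1, Nat.lt_succ_iff.2 h.2, ?_⟩
  have := hτ.2
  omega

end Chains

/-! ### Reduced boundary matrices in terms of leading simplices -/

section Bridge

variable {V : Type*} [DecidableEq V] {n : ℕ}

/-- The boundary matrix with the rows and columns outside a subcomplex set to zero. -/
def relativeBoundaryMatrix (inX : Finset V → Bool) (rows cols : List (Finset V)) :
    Matrix (Fin rows.length) (Fin cols.length) (ZMod 2) :=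
  Matrix.of fun r j => if inX (rows.get r) ∧ inX (cols.get j) then boundaryMatrix rows cols r j else 0

/-- The matrix of the mixup algorithm that computes the boundaries in a subcomplex. -/
noncomputable abbrev mixupMatrix (K : SimplexwiseFiltration V n) (inL inX : Finset V → Bool)
    (k : ℕ) :=
  relativeBoundaryMatrix inX (mixupRows K.simplices inL k) (mixupCols K.simplices k)

variable {K X L : SimplexwiseFiltration V n} {inL inX : Finset V → Bool} {k : ℕ}

/-- Erasing the rows outside `X` loses nothing, because the faces of a simplex of `X` lie in `X`.
The test `inX` is constrained only on simplices of `K`, so that the constant test `true` covers `X =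
K`. -/
theorem mixupMatrix_col
    (hX : ∀ σ ∈ K.total, inX σ = true ↔ σ ∈ X.total) (j) :
    (mixupMatrix K inL inX k).col j = if inX ((mixupCols K.simplices k).get j) then
      chainEntries (mixupRows K.simplices inL k)
        (simplicialBoundary V (Finsupp.single ((mixupCols K.simplices k).get j) 1)) else 0 := by
  ext r
  have hr := mem_mixupRows.1 (List.get_mem (mixupRows K.simplices inL k) r)
  have hj := mem_mixupCols.1 (List.get_mem (mixupCols K.simplices k) j)
  have hlhs : (mixupMatrix K inL inX k).col j r =
      if inX ((mixupRows K.simplices inL k).get r) ∧ inX ((mixupCols K.simplices k).get j) then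
        if (mixupRows K.simplices inL k).get r ⊆ (mixupCols K.simplices k).get j ∧
          ((mixupRows K.simplices inL k).get r).card + 1 = ((mixupCols K.simplices k).get j).card
        then 1 else 0 else 0 := rfl
  rw [hlhs]
  by_cases hinj : inX ((mixupCols K.simplices k).get j) = true
  swap
  · rw [if_neg hinj, if_neg fun h => hinj h.2]
    rfl
  rw [if_pos hinj, chainEntries_apply, simplicialBoundary_single_apply]
  generalize (mixupRows K.simplices inL k).get r = ρ at *
  generalize (mixupCols K.simplices k).get j = τ at *
  have hρ : 0 < ρ.card := Finset.card_pos.2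
    (PreAbstractSimplicialComplex.nonempty_of_mem hr.1)
  by_cases h : ρ ⊆ τ ∧ ρ.card + 1 = τ.card
  · have hρX : inX ρ = true := (hX ρ hr.1).2
      (PreAbstractSimplicialComplex.mem_of_subset ((hX τ hj.1).1 hinj) h.1
        (Finset.card_pos.1 hρ))
    rw [if_pos ⟨hρX, hinj⟩, if_pos h, if_pos ⟨h.1, h.2, by omega⟩]
  · rw [if_neg h, ite_self, if_neg fun h' => h ⟨h'.1, h'.2.1⟩]

/-- The strict bound serves two purposes: `m = i + 1` gives the columns present at index `i`, and
the index of a column's simplex gives the columns to its left. -/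
theorem span_mixupMatrix_col (hXK : X.IsFilteredSubcomplex K)
    (hX : ∀ σ ∈ K.total, inX σ = true ↔ σ ∈ X.total) (m : ℕ) :
    Submodule.span (ZMod 2) ((mixupMatrix K inL inX k).col ''
      {j | K.index ((mixupCols K.simplices k).get j) < m}) =
      (mixupChains K X k m).map
        (chainEntries (mixupRows K.simplices inL k) ∘ₗ simplicialBoundary V) := by
  apply le_antisymm
  · rw [Submodule.span_le]
    rintro _ ⟨j, hj, rfl⟩
    rw [mixupMatrix_col hX]
    split_ifs with h
    · have hc := mem_mixupCols.1 (List.get_mem (mixupCols K.simplices k) j)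
      exact ⟨_, Finsupp.single_mem_supported _ _ ⟨(hX _ hc.1).1 h, hj, hc.2⟩, rfl⟩
    · exact Submodule.zero_mem _
  · rw [mixupChains, Finsupp.supported_eq_span_single, Submodule.map_span, Submodule.span_le]
    rintro _ ⟨_, ⟨τ, ⟨h1, h2, h3⟩, rfl⟩, rfl⟩
    have hK := hXK.total_le h1
    obtain ⟨j, rfl⟩ := List.mem_iff_get.1 (mem_mixupCols.2 ⟨hK, h3⟩)
    refine Submodule.subset_span ⟨j, h2, ?_⟩
    rw [mixupMatrix_col hX, if_pos ((hX _ hK).2 h1)]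
    rfl

theorem boundary_mem_simplicialChains {X : PreAbstractSimplicialComplex V} {k : ℕ}
    {c : Finset V →₀ ZMod 2} (hc : c ∈ simplicialChains X (k + 1)) :
    simplicialBoundary V c ∈ simplicialChains X k := by
  rw [mem_simplicialChains] at hc ⊢
  intro ρ hρ
  obtain ⟨τ, h1, h2, h3, h4⟩ := exists_coface_of_boundary_ne_zero hρ
  have h5 := hc τ h1
  exact ⟨PreAbstractSimplicialComplex.mem_of_subset h5.1 h2 (Finset.card_pos.1 (by omega)),
    by omega⟩

/-- The pivots of the reduced matrix are the leading simplices of the boundaries. -/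
theorem exists_pivot_iff (hXK : X.IsFilteredSubcomplex K)
    (hX : ∀ σ ∈ K.total, inX σ = true ↔ σ ∈ X.total) (hLK : L.total ≤ K.total)
    (hL : ∀ σ, inL σ = true ↔ σ ∈ L.total) {σ : Finset V} (hσ : σ ∈ L.total) (i : ℕ) :
    (∃ t, K.index ((mixupCols K.simplices k).get t) ≤ i ∧
      ∃ r : Fin (mixupRows K.simplices inL k).length,
        pivot (reduceMatrix (mixupMatrix K inL inX k)) t = (r : WithBot _) ∧
        (mixupRows K.simplices inL k).get r = σ ∧ σ.card = k + 1) ↔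
      ∃ x ∈ simplicialBoundaries (X.complex i) k, x ∈ simplicialChains L.total k ∧
        IsLead K.index x σ := by
  have hset : {j | K.index ((mixupCols K.simplices k).get j) ≤ i} =
      {j | K.index ((mixupCols K.simplices k).get j) < i + 1} := by
    ext j
    exact Nat.lt_succ_iff.symm
  have hlower : IsLowerSet {j | K.index ((mixupCols K.simplices k).get j) ≤ i} :=
    fun a b hab ha => (mixupCols_index_strictMono.monotone hab).trans ha
  have hspan := span_mixupMatrix_col (inL := inL) (k := k) hXK hX (i + 1)
  rw [← hset] at hspan
  constructor
  · rintro ⟨t, ht, r, hr, rfl, hcard⟩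
    rw [pivot_eq_coe_iff] at hr
    have hmem := reduceMatrix_col_mem (M := mixupMatrix K inL inX k) hlower ht
    rw [hspan] at hmem
    obtain ⟨c, hc, hce⟩ := hmem
    rw [← hce] at hr
    -- The chain `c` may mix degrees `k` and `k + 1`, but only its part of degree `k + 1`
    -- contributes to rows of `k`-simplices.
    have hent : ∀ s, ((mixupRows K.simplices inL k).get s).card = k + 1 →
        simplicialBoundary V (c.filter fun τ => τ.card = (k + 1) + 1)
          ((mixupRows K.simplices inL k).get s) =
        (chainEntries (mixupRows K.simplices inL k) ∘ₗ simplicialBoundary V) c s := by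
      intro s hs
      rw [simplicialBoundary_filter_apply, if_pos hs]
      rfl
    have hchain := filter_mem_simplicialChains (l := k + 1) hXK hc
    have hbd := boundary_mem_simplicialChains hchain
    -- This is where the order of the rows matters: the pivot lies in `L`, so every other nonzero
    -- entry precedes it and therefore belongs to a simplex of `L` of smaller index.
    have hrow : ∀ ρ, simplicialBoundary V (c.filter fun τ => τ.card = (k + 1) + 1) ρ ≠ 0 →
        ρ ∈ L.total ∧ ρ.card = k + 1 ∧ (ρ ≠ (mixupRows K.simplices inL k).get r →
          K.index ρ < K.index ((mixupRows K.simplices inL k).get r)) := by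
      intro ρ hρ
      have h1 := mem_simplicialChains.1 hbd ρ hρ
      have hρK : ρ ∈ K.total := hXK.total_le (X.complex_le_total _ h1.1)
      obtain ⟨s, rfl⟩ := List.mem_iff_get.1
        (mem_mixupRows (inL := inL).2 ⟨hρK, Or.inr h1.2⟩)
      rw [hent s h1.2] at hρ
      by_cases hsr : s = r
      · rw [hsr]
        exact ⟨hσ, hcard, fun h => absurd rfl h⟩
      · have h2 := mixupRows_of_lt (hr.2 s hρ hsr) ((hL _).2 hσ)
        exact ⟨(hL _).1 h2.1, h1.2, fun _ => h2.2⟩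
    refine ⟨_, ⟨_, hchain, rfl⟩, mem_simplicialChains.2 fun ρ hρ =>
      ⟨(hrow ρ hρ).1, (hrow ρ hρ).2.1⟩, ?_, fun ρ hρ => (hrow ρ hρ).2.2⟩
    rw [hent r hcard]
    exact hr.1
  · rintro ⟨x, ⟨c, hc, rfl⟩, hxL, hlead⟩
    have hcard := (mem_simplicialChains.1 hxL σ hlead.1).2
    obtain ⟨r, rfl⟩ := List.mem_iff_get.1
      (mem_mixupRows (inL := inL) (k := k).2 ⟨hLK hσ, Or.inr hcard⟩)
    have hw : chainEntries (mixupRows K.simplices inL k) (simplicialBoundary V c) ∈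
        Submodule.span (ZMod 2) ((mixupMatrix K inL inX k).col ''
          {j | K.index ((mixupCols K.simplices k).get j) ≤ i}) := by
      rw [hspan]
      exact ⟨c, simplicialChains_le_mixupChains hXK (Or.inr rfl) hc, rfl⟩
    have hwlead : IsLead Fin.val
        (chainEntries (mixupRows K.simplices inL k) (simplicialBoundary V c)) r := by
      refine ⟨hlead.1, fun s hs hsr => ?_⟩
      rw [chainEntries_apply] at hs
      by_contra hlt
      have hrs : r < s := lt_of_le_of_ne (not_lt.1 hlt) (Ne.symm hsr)
      have hsL := (mem_simplicialChains.1 hxL _ hs).1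
      exact absurd (mixupRows_of_lt hrs ((hL _).2 hsL)).2 (not_lt.2 (hlead.le hs))
    have hw0 : chainEntries (mixupRows K.simplices inL k) (simplicialBoundary V c) ≠ 0 :=
      fun h => hwlead.1 (congrFun h r)
    obtain ⟨t, ht, r', h1, h2⟩ := exists_reduceMatrix_lead hlower hw hw0
    obtain rfl := hwlead.unique h2
    exact ⟨t, ht, r, pivot_eq_coe_iff.2 h1, rfl, hcard⟩

theorem findPivot_index_le_iff (hXK : X.IsFilteredSubcomplex K)
    (hX : ∀ σ ∈ K.total, inX σ = true ↔ σ ∈ X.total) (hLK : L.total ≤ K.total)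
    (hL : ∀ σ, inL σ = true ↔ σ ∈ L.total) {σ : Finset V} (hσ : σ ∈ L.total)
    (hcard : σ.card = k + 1) (i : ℕ) :
    (∃ t, findPivot (mixupRows K.simplices inL k)
      (reduceMatrix (mixupMatrix K inL inX k)) σ = some t ∧
        K.index ((mixupCols K.simplices k).get t) ≤ i) ↔
      ∃ x ∈ simplicialBoundaries (X.complex i) k, x ∈ simplicialChains L.total k ∧
        IsLead K.index x σ := by
  rw [← exists_pivot_iff hXK hX hLK hL hσ]
  constructor
  · rintro ⟨t, ht, hti⟩
    obtain ⟨r, hr, hrσ⟩ := of_decide_eq_true (List.find?_some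
      (p := fun t => decide (∃ r : Fin (mixupRows K.simplices inL k).length,
        pivot (reduceMatrix (mixupMatrix K inL inX k)) t = (r : WithBot _) ∧
          (mixupRows K.simplices inL k).get r = σ)) ht)
    exact ⟨t, hti, r, hr, hrσ, hcard⟩
  · rintro ⟨t, hti, r, hr, hrσ, -⟩
    have hsome : (findPivot (mixupRows K.simplices inL k)
        (reduceMatrix (mixupMatrix K inL inX k)) σ).isSome := by
      rw [findPivot, List.find?_isSome]
      exact ⟨t, List.mem_finRange t, decide_eq_true ⟨r, hr, hrσ⟩⟩
    obtain ⟨t', ht'⟩ := Option.isSome_iff_exists.1 hsome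
    obtain ⟨r', hr', hrσ'⟩ := of_decide_eq_true (List.find?_some
      (p := fun t => decide (∃ r : Fin (mixupRows K.simplices inL k).length,
        pivot (reduceMatrix (mixupMatrix K inL inX k)) t = (r : WithBot _) ∧
          (mixupRows K.simplices inL k).get r = σ)) ht')
    -- A simplex of `L` labels only one row, since the index increases strictly along these rows.
    -- Distinct pivots then identify the column found by the search.
    have hrr : r = r' := by
      by_contra hne
      rcases lt_or_gt_of_ne hne with h | h
      · have := (mixupRows_of_lt h (by rw [hrσ']; exact (hL _).2 hσ)).2
        rw [hrσ, hrσ'] at this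
        exact lt_irrefl _ this
      · have := (mixupRows_of_lt h (by rw [hrσ]; exact (hL _).2 hσ)).2
        rw [hrσ, hrσ'] at this
        exact lt_irrefl _ this
    subst hrr
    obtain rfl := reduceMatrix_lead_injective _ (pivot_eq_coe_iff.1 hr) (pivot_eq_coe_iff.1 hr')
    exact ⟨t, ht', hti⟩

/-- The zero columns of the reduced matrix of `L` are the leading simplices of the cycles. -/
theorem reduceMatrix_col_eq_zero_iff_exists_cycle (hLK : L.IsFilteredSubcomplex K)
    (hL : ∀ σ, inL σ = true ↔ σ ∈ L.total) (s : Fin (mixupCols K.simplices k).length)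
    (hs : (mixupCols K.simplices k).get s ∈ L.total)
    (hcard : ((mixupCols K.simplices k).get s).card = k + 1) :
    (∀ r, reduceMatrix (mixupMatrix K inL inL k) r s = 0) ↔
      ∃ z ∈ simplicialCycles (L.complex (K.index ((mixupCols K.simplices k).get s))) k,
        IsLead K.index z ((mixupCols K.simplices k).get s) := by
  have hset : Set.Iio s = {j | K.index ((mixupCols K.simplices k).get j) <
      K.index ((mixupCols K.simplices k).get s)} := by
    ext j
    exact (mixupCols_index_strictMono (K := K) (k := k)).lt_iff_lt.symm
  have hiff : (∀ r, reduceMatrix (mixupMatrix K inL inL k) r s = 0) ↔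
      (reduceMatrix (mixupMatrix K inL inL k)).col s = 0 :=
    ⟨fun h => funext h, fun h r => congrFun h r⟩
  rw [hiff, reduceMatrix_col_eq_zero_iff, hset, span_mixupMatrix_col hLK fun σ _ => hL σ,
    mixupMatrix_col (fun σ _ => hL σ), if_pos ((hL _).2 hs)]
  generalize (mixupCols K.simplices k).get s = σ at *
  constructor
  · rintro ⟨c, hc, hce⟩
    have hσc : c σ = 0 := by
      by_contra h
      exact lt_irrefl _ ((Finsupp.mem_supported _ _).1 hc (Finsupp.mem_support_iff.2 h)).2.1
    -- The chain `c` expresses column `σ` through earlier columns, so the degree `k` part of `σ - c`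
    -- is a cycle led by `σ`.
    set d := Finsupp.single σ 1 - c with hd
    have hdm : d ∈ mixupChains K L k (K.index σ + 1) := by
      refine Submodule.sub_mem _ (Finsupp.single_mem_supported _ _
        ⟨hs, Nat.lt_succ_self _, Or.inl hcard⟩) ?_
      exact Finsupp.supported_mono (t := {τ | τ ∈ L.total ∧ K.index τ < K.index σ + 1 ∧
        (τ.card = k + 1 ∨ τ.card = k + 2)})
        (fun τ hτ => ⟨hτ.1, hτ.2.1.trans (Nat.lt_succ_self _), hτ.2.2⟩) hc
    have hz := filter_mem_simplicialChains (l := k) hLK hdm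
    refine ⟨d.filter fun τ => τ.card = k + 1, ⟨hz, ?_⟩, ?_, ?_⟩
    · change simplicialBoundary V _ = 0
      ext ρ
      rw [Finsupp.zero_apply]
      by_contra hne
      obtain ⟨τ, h1, h2, h3, h4⟩ := exists_coface_of_boundary_ne_zero hne
      have h5 := mem_simplicialChains.1 hz τ h1
      have hρ := PreAbstractSimplicialComplex.mem_of_subset h5.1 h2 (Finset.card_pos.1 (by omega))
      have hρk : ρ.card = k := by omega
      rw [simplicialBoundary_filter_apply, if_pos hρk] at hne
      obtain ⟨r, rfl⟩ := List.mem_iff_get.1 (mem_mixupRows (inL := inL) (k := k).2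
        ⟨hLK.total_le (L.complex_le_total _ hρ), Or.inl hρk⟩)
      have h6 := congrFun hce r
      apply hne
      rw [hd, map_sub, Finsupp.sub_apply, sub_eq_zero]
      exact h6.symm
    · rw [Finsupp.filter_apply_pos (fun τ : Finset V => τ.card = k + 1) _ hcard, hd, Finsupp.sub_apply, hσc]
      simp
    · intro τ hτ hne
      have h1 : d τ ≠ 0 := fun h => hτ (by rw [Finsupp.filter_apply, h, ite_self])
      rw [hd, Finsupp.sub_apply, Finsupp.single_eq_of_ne hne, zero_sub, neg_ne_zero] at h1
      exact ((Finsupp.mem_supported _ _).1 hc (Finsupp.mem_support_iff.2 h1)).2.1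
  · rintro ⟨z, ⟨hz, hz0⟩, hlead⟩
    -- Removing the leading term of the cycle `z` leaves a chain of earlier simplices with the same
    -- boundary as `σ`.
    refine ⟨Finsupp.single σ 1 - z, (Finsupp.mem_supported _ _).2 fun τ hτ => ?_, ?_⟩
    · rw [Finset.mem_coe, Finsupp.mem_support_iff, Finsupp.sub_apply] at hτ
      have hne : τ ≠ σ := by
        rintro rfl
        have key : ∀ a : ZMod 2, a ≠ 0 → 1 - a = 0 := by decide
        exact hτ (by rw [Finsupp.single_eq_same]; exact key _ hlead.1)
      rw [Finsupp.single_eq_of_ne hne, zero_sub, neg_ne_zero] at hτ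
      have h1 := mem_simplicialChains.1 hz τ hτ
      exact ⟨L.complex_le_total _ h1.1, hlead.2 τ hτ hne, Or.inl h1.2⟩
    · have h0 : simplicialBoundary V z = 0 := hz0
      rw [LinearMap.comp_apply, map_sub, h0, sub_zero]

end Bridge
/-! ### Barcodes of quotients of the cycles of the subcomplex -/

section QuotientBarcode

variable {V : Type*} [DecidableEq V] {n : ℕ} {K X L : SimplexwiseFiltration V n} {k : ℕ}

theorem simplicialBoundaries_le_cycles (Y : PreAbstractSimplicialComplex V) (k : ℕ) :
    simplicialBoundaries Y k ≤ simplicialCycles Y k := by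
  rintro _ ⟨c, hc, rfl⟩
  exact ⟨boundary_mem_simplicialChains hc, simplicialBoundary_boundary c⟩

/-- The leading index bounds the whole support, so a cycle of `L` already lives at the index of its
leading simplex. -/
theorem mem_simplicialCycles_of_isLead (hLK : L.IsFilteredSubcomplex K) {x : Finset V →₀ ZMod 2}
    {σ : Finset V} {i : ℕ} (hx : x ∈ simplicialChains L.total k)
    (hx0 : simplicialBoundary V x = 0) (hlead : IsLead K.index x σ) (hi : K.index σ ≤ i) :
    x ∈ simplicialCycles (L.complex i) k := by
  refine ⟨mem_simplicialChains.2 fun τ hτ => ?_, hx0⟩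
  have h := mem_simplicialChains.1 hx τ hτ
  exact ⟨hLK.mem_complex_iff.2 ⟨h.1, (hlead.le hτ).trans hi⟩, h.2⟩

/-- A face enters no later than its coface, and distinct simplices have distinct indices. This makes
all intervals nonempty. -/
theorem index_lt_of_mem_boundaries (hXK : X.IsFilteredSubcomplex K) {x : Finset V →₀ ZMod 2}
    {σ : Finset V} {i : ℕ} (hx : x ∈ simplicialBoundaries (X.complex i) k) (hσ : x σ ≠ 0) :
    K.index σ < i := by
  obtain ⟨c, hc, rfl⟩ := hx
  obtain ⟨τ, h1, h2, h3, h4⟩ := exists_coface_of_boundary_ne_zero hσ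
  have hτ := hXK.le i (mem_simplicialChains.1 hc τ h1).1
  have hτK := K.complex_le_total i hτ
  have hσne : σ.Nonempty := Finset.card_pos.1 (by omega)
  have hle : K.index σ ≤ K.index τ := SimplexwiseFiltration.index_le_of_mem
    (PreAbstractSimplicialComplex.mem_of_subset (SimplexwiseFiltration.mem_index hτK) h2 hσne)
  refine lt_of_lt_of_le (lt_of_le_of_ne hle fun h => ?_)
    (SimplexwiseFiltration.index_le_of_mem hτ)
  have := K.index_injOn (PreAbstractSimplicialComplex.mem_of_subset hτK h2 hσne) hτK h
  rw [this] at h3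
  omega

/-- Common source of both barcodes: `X = L` yields homology and `X = K` yields the image. The
generators are the cycles of `L` in either case; only the boundaries divided out differ. -/
theorem isBarcode_of_cycles (hLK : L.IsFilteredSubcomplex K) (hXK : X.IsFilteredSubcomplex K)
    (M : PersistenceModule n)
    (q : ∀ i : Set.Icc 1 n, simplicialCycles (L.complex i) k →ₗ[ZMod 2] M.obj i)
    (hsurj : ∀ i, Function.Surjective (q i))
    (hnat : ∀ {i j : Set.Icc 1 n} (h : i ≤ j) (x : simplicialCycles (L.complex i) k),
      M.map h (q i x) = q j (Submodule.inclusion (simplicialCycles_mono (L.mono h) k) x))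
    (hker : ∀ i x, q i x = 0 ↔
      (x : Finset V →₀ ZMod 2) ∈ simplicialBoundaries (X.complex i) k)
    {N : ℕ} (σ : Fin N → Finset V) (hσ : Function.Injective σ) (hσL : ∀ j, σ j ∈ L.total)
    (hcyc : ∀ j, ∃ z ∈ simplicialCycles (L.complex (K.index (σ j))) k, IsLead K.index z (σ j))
    (hall : ∀ i, ∀ z ∈ simplicialCycles (L.complex i) k, ∀ s, IsLead K.index z s → ∃ j, s = σ j)
    (d : Fin N → ℕ) (hdn : ∀ j, d j ≤ n + 1)
    (hd : ∀ j, ∀ i ≤ n, d j ≤ i ↔ ∃ x ∈ simplicialBoundaries (X.complex i) k,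
      x ∈ simplicialChains L.total k ∧ IsLead K.index x (σ j)) :
    M.IsBarcode (Finset.univ.val.map fun j => (K.index (σ j), d j)) := by
  -- If the bar dies, its representative is taken among the boundaries at the death index; such a
  -- boundary is also a cycle of `L` at its birth. If `d j = n + 1`, any cycle led by `σ j` will do.
  have hzex : ∀ j, ∃ z : Finset V →₀ ZMod 2, IsLead K.index z (σ j) ∧
      z ∈ simplicialCycles (L.complex (K.index (σ j))) k ∧
        (d j ≤ n → z ∈ simplicialBoundaries (X.complex (d j)) k) := by
    intro j
    by_cases h : d j ≤ n
    · obtain ⟨x, h1, h2, h3⟩ := (hd j (d j) h).1 le_rfl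
      exact ⟨x, h3, mem_simplicialCycles_of_isLead hLK h2
        (simplicialBoundaries_le_cycles _ _ h1).2 h3 le_rfl, fun _ => h1⟩
    · obtain ⟨z, h1, h2⟩ := hcyc j
      exact ⟨z, h2, h1, fun h' => absurd h' h⟩
  choose z hz hzZ hzB using hzex
  have hchain : ∀ {i : ℕ} {x : Finset V →₀ ZMod 2}, x ∈ simplicialCycles (L.complex i) k →
      x ∈ simplicialChains L.total k :=
    fun {i _} hx => simplicialChains_mono (L.complex_le_total i) k hx.1
  refine M.isBarcode_of_isLead K.index (fun i => simplicialCycles (L.complex i) k)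
    (fun h => simplicialCycles_mono (L.mono h) k) q hsurj hnat ?_ σ z _ ?_ ?_ hz ?_ ?_ ?_ ?_
  · intro i x hx
    exact K.index_injOn.mono fun τ hτ => hLK.total_le
      (mem_simplicialChains.1 (hchain hx) τ (Finsupp.mem_support_iff.1 hτ)).1
  · intro j
    refine ⟨SimplexwiseFiltration.index_pos (hLK.total_le (hσL j)), ?_, hdn j⟩
    by_cases h : d j ≤ n
    · exact index_lt_of_mem_boundaries hXK (hzB j h) (hz j).1
    · exact lt_of_le_of_lt (SimplexwiseFiltration.index_le (hLK.total_le (hσL j))) (not_le.1 h)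
  · intro a b h
    exact hσ (K.index_injOn (hLK.total_le (hσL a)) (hLK.total_le (hσL b)) h)
  · intro i j h
    exact simplicialCycles_mono (L.mono h) k (hzZ j)
  · intro i j h hji
    rw [hker]
    exact simplicialBoundaries_mono (X.mono hji) k (hzB j (le_trans hji i.2.2))
  · intro i x hx s hs
    obtain ⟨j, rfl⟩ := hall i x hx s hs
    exact ⟨j, rfl, (hLK.mem_complex_iff.1 (mem_simplicialChains.1 hx.1 _ hs.1).1).2⟩
  · intro i x hx s hs
    obtain ⟨j, rfl⟩ := hall i x x.2 s hs
    exact ⟨j, rfl, (hd j i i.2.2).2 ⟨x, (hker i x).1 hx, hchain x.2, hs⟩⟩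

theorem homology_isBarcode (hLK : L.IsFilteredSubcomplex K)
    {N : ℕ} (σ : Fin N → Finset V) (hσ : Function.Injective σ) (hσL : ∀ j, σ j ∈ L.total)
    (hcyc : ∀ j, ∃ z ∈ simplicialCycles (L.complex (K.index (σ j))) k, IsLead K.index z (σ j))
    (hall : ∀ i, ∀ z ∈ simplicialCycles (L.complex i) k, ∀ s, IsLead K.index z s → ∃ j, s = σ j)
    (d : Fin N → ℕ) (hdn : ∀ j, d j ≤ n + 1)
    (hd : ∀ j, ∀ i ≤ n, d j ≤ i ↔ ∃ x ∈ simplicialBoundaries (L.complex i) k,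
      x ∈ simplicialChains L.total k ∧ IsLead K.index x (σ j)) :
    (L.homology k).IsBarcode (Finset.univ.val.map fun j => (K.index (σ j), d j)) :=
  isBarcode_of_cycles hLK hLK (L.homology k)
    (fun i => (boundariesInCycles (L.complex i) k).mkQ)
    (fun _ => Submodule.mkQ_surjective _) (fun _ _ => rfl)
    (fun i _ => Submodule.Quotient.mk_eq_zero (boundariesInCycles (L.complex i) k))
    σ hσ hσL hcyc hall d hdn hd

/-- At index `i` the image is the quotient of `Z_k(L_i)` by those of its elements that bound in
`K_i`. -/
theorem image_homologyMap_isBarcode (hLK : L.IsFilteredSubcomplex K)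
    {N : ℕ} (σ : Fin N → Finset V) (hσ : Function.Injective σ) (hσL : ∀ j, σ j ∈ L.total)
    (hcyc : ∀ j, ∃ z ∈ simplicialCycles (L.complex (K.index (σ j))) k, IsLead K.index z (σ j))
    (hall : ∀ i, ∀ z ∈ simplicialCycles (L.complex i) k, ∀ s, IsLead K.index z s → ∃ j, s = σ j)
    (d : Fin N → ℕ) (hdn : ∀ j, d j ≤ n + 1)
    (hd : ∀ j, ∀ i ≤ n, d j ≤ i ↔ ∃ x ∈ simplicialBoundaries (K.complex i) k,
      x ∈ simplicialChains L.total k ∧ IsLead K.index x (σ j)) :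
    (SimplexwiseFiltration.homologyMap hLK.le k).image.IsBarcode
      (Finset.univ.val.map fun j => (K.index (σ j), d j)) := by
  refine isBarcode_of_cycles hLK K.isFilteredSubcomplex_self
    (SimplexwiseFiltration.homologyMap hLK.le k).image
    (fun i => (simplicialHomologyMap (hLK.le i) k).rangeRestrict ∘ₗ
      (boundariesInCycles (L.complex i) k).mkQ) (fun i => ?_) (fun _ _ => rfl)
    (fun i x => ?_) σ hσ hσL hcyc hall d hdn hd
  · exact (LinearMap.surjective_rangeRestrict _).comp (Submodule.mkQ_surjective _)
  · refine Subtype.ext_iff.trans ?_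
    exact Submodule.Quotient.mk_eq_zero (boundariesInCycles (K.complex i) k)

end QuotientBarcode

/-! ### The output of the algorithm -/

section Values

variable {V : Type*} {n : ℕ}

open Classical in
/-- The test for membership in the total complex. -/
noncomputable abbrev totalTest (L : SimplexwiseFiltration V n) (σ : Finset V) : Bool :=
  decide (σ ∈ L.total)

theorem totalTest_iff (L : SimplexwiseFiltration V n) (σ : Finset V) :
    totalTest L σ = true ↔ σ ∈ L.total := by
  simp [totalTest]

/-- The value of the simplex of a column, or `∞`. -/
def columnValue {α : Type*} (cols : List (Finset V)) (f : Finset V → α)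
    (t : Option (Fin cols.length)) : WithTop α :=
  match t with
  | some τ => (f (cols.get τ) : WithTop α)
  | none => ⊤

variable {K : SimplexwiseFiltration V n} {k : ℕ}

/-- Every genuine index is at most `n`, so writing `n + 1` for `∞` does not confuse the two and the
order carries over to the values. -/
theorem columnValue_mono {f : Finset V → ℝ} (hf : K.OrderPreserving f)
    {s t : Option (Fin (mixupCols K.simplices k).length)}
    (h : (columnValue _ K.index s).untopD (n + 1) ≤ (columnValue _ K.index t).untopD (n + 1)) :
    columnValue _ f s ≤ columnValue _ f t := by
  cases t with
  | none => exact le_top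
  | some t =>
    have ht := (mem_mixupCols.1 (List.get_mem (mixupCols K.simplices k) t)).1
    cases s with
    | none =>
      have h1 := SimplexwiseFiltration.index_le ht
      have h2 : n + 1 ≤ K.index ((mixupCols K.simplices k).get t) := h
      omega
    | some s =>
      have hs := (mem_mixupCols.1 (List.get_mem (mixupCols K.simplices k) s)).1
      exact WithTop.coe_le_coe.2 (hf _ hs _ ht h)

theorem hasFiltrationValue_columnValue {α : Type*} (f : Finset V → α)
    (t : Option (Fin (mixupCols K.simplices k).length)) :
    K.HasFiltrationValue f ((columnValue _ K.index t).untopD (n + 1)) (columnValue _ f t) := by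
  cases t with
  | none => exact Or.inl ⟨rfl, rfl⟩
  | some t =>
    exact Or.inr ⟨_, (mem_mixupCols.1 (List.get_mem (mixupCols K.simplices k) t)).1, rfl, rfl⟩

end Values

/-! ### The recorded triples as births and deaths -/

section Output

variable {V : Type*} [DecidableEq V] {n : ℕ}

/-- The `k`-simplices of `L` whose column in the reduced matrix of `L` is zero. -/
noncomputable def zeroColumns (L K : SimplexwiseFiltration V n) (k : ℕ) :
    List (Fin (mixupCols K.simplices k).length) :=
  (List.finRange (mixupCols K.simplices k).length).filter fun s =>
    decide (((mixupCols K.simplices k).get s).card = k + 1 ∧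
      totalTest L ((mixupCols K.simplices k).get s) ∧
        ∀ r, reduceMatrix (mixupMatrix K (totalTest L) (totalTest L) k) r s = 0)

/-- The column of the reduced matrix of the complex tested by `inX` with pivot `σ`. -/
noncomputable def deathColumn (L K : SimplexwiseFiltration V n) (inX : Finset V → Bool) (k : ℕ)
    (σ : Finset V) : Option (Fin (mixupCols K.simplices k).length) :=
  findPivot (mixupRows K.simplices (totalTest L) k)
    (reduceMatrix (mixupMatrix K (totalTest L) inX k)) σ

/-- Presents `BK` as the case of the constant test, so that `BL` and `BK` are handled by the same
lemmas. -/
theorem mixupMatrix_true (K : SimplexwiseFiltration V n) (inL : Finset V → Bool) (k : ℕ) :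
    mixupMatrix K inL (fun _ => true) k =
      boundaryMatrix (mixupRows K.simplices inL k) (mixupCols K.simplices k) := by
  refine Matrix.ext fun r j => ?_
  simp only [mixupMatrix, relativeBoundaryMatrix, Matrix.of_apply, and_self, if_true]

theorem mixupOutput_eq (L K : SimplexwiseFiltration V n) {α : Type*} (f : Finset V → α) (k : ℕ) :
    mixupOutput L K f k = (zeroColumns L K k).map fun s =>
      (f ((mixupCols K.simplices k).get s),
        columnValue _ f (deathColumn L K (fun _ => true) k ((mixupCols K.simplices k).get s)),
        columnValue _ f (deathColumn L K (totalTest L) k ((mixupCols K.simplices k).get s))) := by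
  simp only [deathColumn, mixupMatrix_true]
  rfl

variable {L K : SimplexwiseFiltration V n} {k : ℕ}

theorem mem_zeroColumns (hLK : L.IsFilteredSubcomplex K)
    {s : Fin (mixupCols K.simplices k).length} :
    s ∈ zeroColumns L K k ↔ ((mixupCols K.simplices k).get s).card = k + 1 ∧
      (mixupCols K.simplices k).get s ∈ L.total ∧
      ∃ z ∈ simplicialCycles (L.complex (K.index ((mixupCols K.simplices k).get s))) k,
        IsLead K.index z ((mixupCols K.simplices k).get s) := by
  simp only [zeroColumns, List.mem_filter, List.mem_finRange, true_and, decide_eq_true_eq]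
  refine and_congr_right fun hcard => and_congr_right fun hs => ?_
  exact reduceMatrix_col_eq_zero_iff_exists_cycle hLK (totalTest_iff L) s hs hcard

/-- The index of the death column, with `n + 1` in the place of `∞`. -/
noncomputable def deathIndex (L K : SimplexwiseFiltration V n) (inX : Finset V → Bool) (k : ℕ)
    (σ : Finset V) : ℕ :=
  (columnValue _ K.index (deathColumn L K inX k σ)).untopD (n + 1)

theorem deathIndex_le (inX : Finset V → Bool) (σ : Finset V) :
    deathIndex L K inX k σ ≤ n + 1 := by
  unfold deathIndex
  cases deathColumn L K inX k σ with
  | none => exact le_rfl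
  | some t =>
    have ht := (mem_mixupCols.1 (List.get_mem (mixupCols K.simplices k) t)).1
    exact (SimplexwiseFiltration.index_le ht).trans (Nat.le_succ n)

/-- The restriction to `i ≤ n` is needed because a missing pivot is recorded as `n + 1`. -/
theorem deathIndex_le_iff (hLK : L.IsFilteredSubcomplex K) {X : SimplexwiseFiltration V n}
    (hXK : X.IsFilteredSubcomplex K) {inX : Finset V → Bool}
    (hX : ∀ σ ∈ K.total, inX σ = true ↔ σ ∈ X.total) {σ : Finset V} (hσ : σ ∈ L.total)
    (hcard : σ.card = k + 1) {i : ℕ} (hi : i ≤ n) :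
    deathIndex L K inX k σ ≤ i ↔ ∃ x ∈ simplicialBoundaries (X.complex i) k,
      x ∈ simplicialChains L.total k ∧ IsLead K.index x σ := by
  rw [← findPivot_index_le_iff (inL := totalTest L) hXK hX hLK.total_le
    (totalTest_iff L) hσ hcard]
  change deathIndex L K inX k σ ≤ i ↔ ∃ t, deathColumn L K inX k σ = some t ∧ _
  unfold deathIndex
  cases deathColumn L K inX k σ with
  | none =>
    simp only [columnValue, WithTop.untopD_top, reduceCtorEq, false_and, exists_false, iff_false]
    omega
  | some t =>
    simp only [Option.some.injEq, exists_eq_left']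
    rfl

theorem mixupIndexOutput_eq (L K : SimplexwiseFiltration V n) (k : ℕ) :
    mixupIndexOutput L K k = (zeroColumns L K k).map fun s =>
      (K.index ((mixupCols K.simplices k).get s),
        deathIndex L K (fun _ => true) k ((mixupCols K.simplices k).get s),
        deathIndex L K (totalTest L) k ((mixupCols K.simplices k).get s)) := by
  rw [mixupIndexOutput, mixupOutput_eq, List.map_map]
  rfl

theorem deathIndex_bounds (hLK : L.IsFilteredSubcomplex K) {σ : Finset V} (hσ : σ ∈ L.total)
    (hcard : σ.card = k + 1) :
    K.index σ ≤ deathIndex L K (fun _ => true) k σ ∧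
      deathIndex L K (fun _ => true) k σ ≤ deathIndex L K (totalTest L) k σ := by
  have hXK : ∀ σ ∈ K.total, (fun _ => true : Finset V → Bool) σ = true ↔ σ ∈ K.total :=
    fun σ hσ => iff_of_true rfl hσ
  constructor
  · by_cases h : deathIndex L K (fun _ => true) k σ ≤ n
    · obtain ⟨x, h1, -, h3⟩ :=
        (deathIndex_le_iff hLK K.isFilteredSubcomplex_self hXK hσ hcard h).1 le_rfl
      exact (index_lt_of_mem_boundaries K.isFilteredSubcomplex_self h1 h3.1).le
    · exact (SimplexwiseFiltration.index_le (hLK.total_le hσ)).trans (not_le.1 h).le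
  · by_cases h : deathIndex L K (totalTest L) k σ ≤ n
    · obtain ⟨x, h1, h2, h3⟩ :=
        (deathIndex_le_iff hLK hLK (fun τ _ => totalTest_iff L τ) hσ hcard h).1 le_rfl
      exact (deathIndex_le_iff hLK K.isFilteredSubcomplex_self hXK hσ hcard h).2
        ⟨x, simplicialBoundaries_mono (hLK.le _) k h1, h2, h3⟩
    · exact (deathIndex_le _ _).trans (not_le.1 h)

theorem isMixupBarcode_mixupIndexOutput (hLK : L.IsFilteredSubcomplex K) :
    IsMixupBarcode hLK k (mixupIndexOutput L K k : Multiset (ℕ × ℕ × ℕ)) := by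
  set σ : Fin (zeroColumns L K k).length → Finset V := fun j =>
    (mixupCols K.simplices k).get ((zeroColumns L K k).get j)
  have hmem : ∀ j, (zeroColumns L K k).get j ∈ zeroColumns L K k := fun j => List.get_mem _ _
  have hnodup : (zeroColumns L K k).Nodup := (List.nodup_finRange _).filter _
  have hσ : Function.Injective σ := by
    intro a b h
    have h1 := (mixupCols_index_strictMono (K := K) (k := k)).injective (congrArg K.index h)
    exact List.nodup_iff_injective_get.1 hnodup h1
  have hcard : ∀ j, (σ j).card = k + 1 := fun j => ((mem_zeroColumns hLK).1 (hmem j)).1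
  have hσL : ∀ j, σ j ∈ L.total := fun j => ((mem_zeroColumns hLK).1 (hmem j)).2.1
  have hcyc := fun j => ((mem_zeroColumns hLK).1 (hmem j)).2.2
  -- The leading simplex of any cycle is a birth: the cycle is already present at the index of that
  -- simplex, whose column is therefore zero.
  have hall : ∀ i, ∀ z ∈ simplicialCycles (L.complex i) k, ∀ s, IsLead K.index z s →
      ∃ j, s = σ j := by
    intro i z hz s hs
    have h1 := mem_simplicialChains.1 hz.1 s hs.1
    have hsL := L.complex_le_total _ h1.1
    obtain ⟨t, rfl⟩ := List.mem_iff_get.1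
      (mem_mixupCols (K := K) (k := k).2 ⟨hLK.total_le hsL, Or.inl h1.2⟩)
    have h2 : t ∈ zeroColumns L K k := (mem_zeroColumns hLK).2 ⟨h1.2, hsL, z,
      mem_simplicialCycles_of_isLead hLK (simplicialChains_mono (L.complex_le_total i) k hz.1)
        hz.2 hs le_rfl, hs⟩
    obtain ⟨j, rfl⟩ := List.mem_iff_get.1 h2
    exact ⟨j, rfl⟩
  have hlist : ∀ {β : Type} (g : Finset V → β),
      (((zeroColumns L K k).map fun s => g ((mixupCols K.simplices k).get s) : List β) :
        Multiset β) = Finset.univ.val.map fun j => g (σ j) := by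
    intro β g
    rw [Fin.univ_val_map]
    congr 1
    conv_lhs => rw [← List.ofFn_get (zeroColumns L K k), List.map_ofFn]
    rfl
  -- No interval is left unmatched: a birth simplex cannot lead a boundary of `K` at its own index,
  -- so every image interval is nonempty.
  refine ⟨mixupIndexOutput L K k, 0, ?_, ?_, by simp⟩
  · have h := homology_isBarcode hLK σ hσ hσL hcyc hall
      (fun j => deathIndex L K (totalTest L) k (σ j)) (fun j => deathIndex_le _ _)
      (fun j i hi => deathIndex_le_iff hLK hLK (fun τ _ => totalTest_iff L τ) (hσL j) (hcard j) hi)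
    rw [← hlist fun τ => (K.index τ, deathIndex L K (totalTest L) k τ)] at h
    rw [mixupIndexOutput_eq, add_zero, Multiset.map_coe, List.map_map]
    exact h
  · have h := image_homologyMap_isBarcode hLK σ hσ hσL hcyc hall
      (fun j => deathIndex L K (fun _ => true) k (σ j)) (fun j => deathIndex_le _ _)
      (fun j i hi => deathIndex_le_iff hLK K.isFilteredSubcomplex_self
        (fun σ hσ => iff_of_true rfl hσ) (hσL j) (hcard j) hi)
    rw [← hlist fun τ => (K.index τ, deathIndex L K (fun _ => true) k τ)] at h
    rw [mixupIndexOutput_eq, Multiset.map_coe, List.map_map]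
    exact h

end Output

theorem mainTheorem1 {V : Type*} [DecidableEq V] {n : ℕ} (L K : SimplexwiseFiltration V n)
    (hLK : L.IsFilteredSubcomplex K) (k : ℕ) :
    IsMixupBarcode hLK k (mixupIndexOutput L K k : Multiset (ℕ × ℕ × ℕ)) ∧
    (∀ t ∈ mixupIndexOutput L K k,
      1 ≤ t.1 ∧ t.1 ≤ t.2.1 ∧ t.2.1 ≤ t.2.2 ∧ t.2.2 ≤ n + 1) ∧
    ∀ f : Finset V → ℝ, K.OrderPreserving f →
      IsMixupBarcodeWithValues hLK k f
        (mixupOutput L K f k : Multiset (ℝ × WithTop ℝ × WithTop ℝ)) ∧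
      ∀ t ∈ mixupOutput L K f k, (t.1 : WithTop ℝ) ≤ t.2.1 ∧ t.2.1 ≤ t.2.2 := by
  refine ⟨isMixupBarcode_mixupIndexOutput hLK, ?_, fun f hf => ⟨?_, ?_⟩⟩
  · intro t ht
    rw [mixupIndexOutput_eq] at ht
    obtain ⟨s, hs, rfl⟩ := List.mem_map.1 ht
    obtain ⟨hcard, hsL, -⟩ := (mem_zeroColumns hLK).1 hs
    have h := deathIndex_bounds hLK hsL hcard
    exact ⟨SimplexwiseFiltration.index_pos (hLK.total_le hsL), h.1, h.2, deathIndex_le _ _⟩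
  · refine ⟨_, isMixupBarcode_mixupIndexOutput hLK, ?_⟩
    rw [mixupIndexOutput_eq, mixupOutput_eq, ← Multiset.map_coe, ← Multiset.map_coe,
      Multiset.rel_map]
    -- The zero columns do not depend on `f`, so the index output and the value output correspond
    -- column by column.
    refine Multiset.rel_refl_of_refl_on fun s hs => ?_
    have hsK := (mem_mixupCols.1 (List.get_mem (mixupCols K.simplices k) s)).1
    exact ⟨Or.inr ⟨_, hsK, rfl, rfl⟩, hasFiltrationValue_columnValue f _,
      hasFiltrationValue_columnValue f _⟩
  · intro t ht
    rw [mixupOutput_eq] at ht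
    obtain ⟨s, hs, rfl⟩ := List.mem_map.1 ht
    obtain ⟨hcard, hsL, -⟩ := (mem_zeroColumns hLK).1 hs
    have h := deathIndex_bounds hLK hsL hcard
    exact ⟨columnValue_mono (s := some s) hf h.1, columnValue_mono hf h.2⟩
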